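/- For positive integers $p,q$ let $$\mathcal Z_{p,q}=\{f\in C([0,1],\mathbb M_p\otimes\mathbb M_q) : f(0)\in\mathbb M_p\otimes 1_q,\ f(1)\in 1_p\otimes\mathbb M_q\}$$ be the dimension drop algebra, called prime if $p$ and $q$ are coprime, and write $c(f(0))\in\mathbb M_p$, $c(f(1))\in\mathbb M_q$ for the matrices with $f(0)=c(f(0))\otimes 1_q$ and $f(1)=1_p\otimes c(f(1))$. Every unital $*$-homomorphism $\iota\colon\mathcal Z_{p,q}\to\mathcal Z_{p',q'}$ is of the form $$\iota(f)(s)=v_s\,\operatorname{diag}\bigl[\underbrace{c(f(0)),\dots,c(f(0))}_{a},\,f(t_1(s)),\dots,f(t_k(s)),\,\underbrace{c(f(1)),\dots,c(f(1))}_{b}\bigr]\,v_s^*\qquad(f\in\mathcal Z_{p,q},\ s\in[0,1])$$ for integers $0\le a<q$, $0\le b<p$, continuous maps $t_1,\dots,t_k\colon[0,1]\to[0,1]$ and unitary matrices $v_s$ of size $p'q'$ (not necessarily continuous in $s$). Under the normalization $t_1\le\dots\le t_k$ the maps $t_1,\dots,t_k$ are unique; they form the normalized eigenvalue pattern of $\iota$.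 The variation of $\iota$ is $V(\iota)=\max_i\operatorname{diam}t_i([0,1])$ (and $V(\iota)=0$ if $k=0$), where $t_1\le\dots\le t_k$ is the normalized eigenvalue pattern of $\iota$. **Proposition.** Let $\{\iota_{n,m}\colon\mathcal Z_{p_m,q_m}\to\mathcal Z_{p_n,q_n}\}_{m\le n}$ be an inductive system, indexed by the natural numbers, of prime dimension drop algebras and unital $*$-homomorphisms, and let $\mathcal Z_0$ be its C*-algebraic inductive limit. Then $\mathcal Z_0$ is simple and monotracial (that is, it has no closed two-sided ideals other than $0$ and $\mathcal Z_0\neq 0$, and it has exactly one tracial state) if and only if $\lim_{n\to\infty}V(\iota_{n,m})=0$ for each $m$. -/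

import Mathlib

open Filter Topology
open scoped Kronecker Matrix.Norms.L2Operator ENNReal

noncomputable section

namespace JiangSu

/-! ### Inductive limits of sequences of unital C*-algebras -/

/-- An inductive system `A 0 → A 1 → A 2 → ⋯` of unital C*-algebras and unital
`*`-homomorphisms; `S.map h : A m → A n` is the connecting map for `h : m ≤ n`. -/
structure CStarSystem (A : ℕ → Type*) [∀ n, CStarAlgebra (A n)] where
  map : ∀ {m n : ℕ}, m ≤ n → A m →⋆ₐ[ℂ] A n
  map_self : ∀ (n : ℕ) (x : A n), map (le_refl n) x = x
  map_map : ∀ {l m n : ℕ} (h₁ : l ≤ m) (h₂ : m ≤ n) (x : A l),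
    map h₂ (map h₁ x) = map (h₁.trans h₂) x

namespace CStarSystem

variable {A : ℕ → Type*} [∀ n, CStarAlgebra (A n)] (S : CStarSystem A)

/-- The `*`-algebra of sequences `x` that are eventually coherent: from some index `m` on,
`x n` is the image of `x m` under the connecting map. Modulo the sequences that are eventually
zero this is the algebraic inductive limit. -/
def coherent : StarSubalgebra ℂ (∀ n, A n) where
  carrier := {x | ∃ m, ∀ (n : ℕ) (h : m ≤ n), S.map h (x m) = x n}
  mul_mem' := by
    rintro x y ⟨m, hm⟩ ⟨k, hk⟩
    refine ⟨max m k, fun n h => ?_⟩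
    have h1 := (hm _ (le_max_left m k))
    have h2 := (hk _ (le_max_right m k))
    rw [Pi.mul_apply, Pi.mul_apply, map_mul, ← h1, ← h2, S.map_map, S.map_map, hm, hk]
  add_mem' := by
    rintro x y ⟨m, hm⟩ ⟨k, hk⟩
    refine ⟨max m k, fun n h => ?_⟩
    have h1 := (hm _ (le_max_left m k))
    have h2 := (hk _ (le_max_right m k))
    rw [Pi.add_apply, Pi.add_apply, map_add, ← h1, ← h2, S.map_map, S.map_map, hm, hk]
  algebraMap_mem' r := ⟨0, fun n h => by
    rw [Pi.algebraMap_apply, Pi.algebraMap_apply, AlgHomClass.commutes]⟩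
  star_mem' := by
    rintro x ⟨m, hm⟩
    exact ⟨m, fun n h => by rw [Pi.star_apply, Pi.star_apply, map_star, hm]⟩

/-- The algebra of eventually coherent sequences, to be given the seminorm
`‖x‖ = lim_n ‖x n‖` (and not a structure inherited from the product). -/
def PreLimit : Type _ := S.coherent

instance : Ring S.PreLimit := inferInstanceAs (Ring S.coherent)
instance : Algebra ℂ S.PreLimit := inferInstanceAs (Algebra ℂ S.coherent)
instance : StarRing S.PreLimit := inferInstanceAs (StarRing S.coherent)
instance : StarModule ℂ S.PreLimit := inferInstanceAs (StarModule ℂ S.coherent)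

variable {S}

/-- The `n`-th entry of an eventually coherent sequence. -/
def PreLimit.entry (x : S.PreLimit) (n : ℕ) : A n := x.1 n

instance : Norm S.PreLimit := ⟨fun x => limsup (fun n => ‖x.entry n‖) atTop⟩

theorem PreLimit.norm_def (x : S.PreLimit) : ‖x‖ = limsup (fun n => ‖x.entry n‖) atTop := rfl

theorem PreLimit.tendsto_norm (x : S.PreLimit) :
    Tendsto (fun n => ‖x.entry n‖) atTop (𝓝 ‖x‖) := by
  obtain ⟨m, hm⟩ := x.2
  have hm' : ∀ (n : ℕ) (h : m ≤ n), S.map h (x.entry m) = x.entry n := hm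
  have hanti : Antitone (fun d => ‖x.entry (m + d)‖) := by
    refine antitone_nat_of_succ_le fun d => ?_
    rw [← hm' (m + (d + 1)) (by omega), ← S.map_map (by omega : m ≤ m + d) (by omega),
      hm' (m + d)]
    exact NonUnitalStarAlgHom.norm_apply_le _ _
  have h1 : ∃ l, Tendsto (fun d => ‖x.entry (m + d)‖) atTop (𝓝 l) :=
    ⟨_, tendsto_atTop_ciInf hanti ⟨0, by rintro _ ⟨d, rfl⟩; exact norm_nonneg _⟩⟩
  obtain ⟨l, hl⟩ := h1
  have h2 : Tendsto (fun n => ‖x.entry n‖) atTop (𝓝 l) := by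
    rw [← tendsto_add_atTop_iff_nat m]
    exact hl.congr fun d => by rw [add_comm m d]
  rw [PreLimit.norm_def, h2.limsup_eq]
  exact h2

instance : SeminormedRing S.PreLimit :=
  { (inferInstance : Ring S.PreLimit),
    AddGroupSeminorm.toSeminormedAddCommGroup (E := S.PreLimit)
      { toFun := fun x => ‖x‖
        map_zero' := tendsto_nhds_unique (PreLimit.tendsto_norm 0) <| by
          refine tendsto_const_nhds.congr fun n => ?_
          exact (norm_zero (E := A n)).symm
        add_le' := fun x y =>
          le_of_tendsto_of_tendsto' (PreLimit.tendsto_norm (x + y))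
            ((PreLimit.tendsto_norm x).add (PreLimit.tendsto_norm y))
            fun n => norm_add_le (x.entry n) (y.entry n)
        neg' := fun x => tendsto_nhds_unique (PreLimit.tendsto_norm (-x)) <|
          (PreLimit.tendsto_norm x).congr fun n => (norm_neg (x.entry n)).symm } with
    norm_mul_le := fun x y =>
      le_of_tendsto_of_tendsto' (PreLimit.tendsto_norm (x * y))
        ((PreLimit.tendsto_norm x).mul (PreLimit.tendsto_norm y))
        fun n => norm_mul_le (x.entry n) (y.entry n) }

instance : NormedAlgebra ℂ S.PreLimit :=
  { (inferInstance : Algebra ℂ S.PreLimit) with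
    norm_smul_le := fun r x =>
      le_of_tendsto_of_tendsto' (PreLimit.tendsto_norm (r • x))
        ((PreLimit.tendsto_norm x).const_mul ‖r‖)
        fun n => norm_smul_le r (x.entry n) }

instance : NormedStarGroup S.PreLimit where
  norm_star_le x := le_of_tendsto_of_tendsto' (PreLimit.tendsto_norm (star x))
    (PreLimit.tendsto_norm x) fun n => (norm_star (x.entry n)).le

theorem PreLimit.norm_sq_le (x : S.PreLimit) : ‖x‖ * ‖x‖ ≤ ‖star x * x‖ :=
  le_of_tendsto_of_tendsto' ((PreLimit.tendsto_norm x).mul (PreLimit.tendsto_norm x))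
    (PreLimit.tendsto_norm (star x * x))
    fun n => (CStarRing.norm_star_mul_self (x := x.entry n)).ge

variable (S)

open UniformSpace

/-- The C*-algebraic inductive limit of the system: the (Hausdorff) completion of the algebraic
inductive limit with respect to the C*-seminorm `lim_n ‖x n‖`. -/
def Limit : Type _ := Completion S.PreLimit

instance : NormedRing S.Limit := inferInstanceAs (NormedRing (Completion S.PreLimit))
instance : CompleteSpace S.Limit := inferInstanceAs (CompleteSpace (Completion S.PreLimit))
instance : Algebra ℂ S.Limit := inferInstanceAs (Algebra ℂ (Completion S.PreLimit))

variable {S}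

/-- The class in the inductive limit of an eventually coherent sequence. -/
def PreLimit.toLimit (x : S.PreLimit) : S.Limit := (x : Completion S.PreLimit)

theorem Limit.ind {P : S.Limit → Prop} (x : S.Limit) (hc : IsClosed {y | P y})
    (h : ∀ y : S.PreLimit, P y.toLimit) : P x :=
  Completion.induction_on (α := S.PreLimit) x hc h

theorem Limit.norm_toLimit (x : S.PreLimit) : ‖x.toLimit‖ = ‖x‖ := Completion.norm_coe x

theorem Limit.toLimit_mul (x y : S.PreLimit) : (x * y).toLimit = x.toLimit * y.toLimit :=
  Completion.coe_mul x y

theorem Limit.toLimit_add (x y : S.PreLimit) : (x + y).toLimit = x.toLimit + y.toLimit :=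
  Completion.coe_add x y

theorem Limit.toLimit_smul (r : ℂ) (x : S.PreLimit) : (r • x).toLimit = r • x.toLimit :=
  Completion.coe_smul r x

instance : NormedAlgebra ℂ S.Limit :=
  { (inferInstance : Algebra ℂ S.Limit) with
    norm_smul_le := fun r x =>
      norm_smul_le (α := ℂ) (β := Completion S.PreLimit) r x }

instance : Star S.Limit := ⟨Completion.map (star : S.PreLimit → S.PreLimit)⟩

theorem Limit.toLimit_star (x : S.PreLimit) : (star x).toLimit = star x.toLimit :=
  (Completion.map_coe (f := (star : S.PreLimit → S.PreLimit))
    (_root_.star_isometry (E := S.PreLimit)).uniformContinuous x).symm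

theorem Limit.continuous_star : Continuous (star : S.Limit → S.Limit) :=
  Completion.continuous_map (f := (star : S.PreLimit → S.PreLimit))

instance : ContinuousStar S.Limit := ⟨Limit.continuous_star⟩

instance : StarRing S.Limit where
  star_involutive x := by
    refine Limit.ind (P := fun x => star (star x) = x) x (isClosed_eq (by fun_prop) (by fun_prop)) fun y => ?_
    rw [← Limit.toLimit_star, ← Limit.toLimit_star, star_star]
  star_mul x y := by
    refine Limit.ind (P := fun x => star (x * y) = star y * star x) x (isClosed_eq (by fun_prop) (by fun_prop)) fun a => ?_
    refine Limit.ind (P := fun y => star (a.toLimit * y) = star y * star a.toLimit) y (isClosed_eq (by fun_prop) (by fun_prop)) fun b => ?_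
    simp only [← Limit.toLimit_star, ← Limit.toLimit_mul, star_mul]
  star_add x y := by
    refine Limit.ind (P := fun x => star (x + y) = star x + star y) x (isClosed_eq (by fun_prop) (by fun_prop)) fun a => ?_
    refine Limit.ind (P := fun y => star (a.toLimit + y) = star a.toLimit + star y) y (isClosed_eq (by fun_prop) (by fun_prop)) fun b => ?_
    simp only [← Limit.toLimit_star, ← Limit.toLimit_add, star_add]

theorem Limit.star_smul (r : ℂ) (x : S.Limit) : star (r • x) = star r • star x := by
  have h : Continuous fun y : S.Limit => r • y := continuous_const_smul r
  have h' : Continuous fun y : S.Limit => star r • y := continuous_const_smul (star r)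
  refine Limit.ind (P := fun x => star (r • x) = star r • star x) x
    (isClosed_eq (Limit.continuous_star.comp h) (h'.comp Limit.continuous_star)) fun y => ?_
  rw [← Limit.toLimit_smul, ← Limit.toLimit_star, ← Limit.toLimit_star, StarModule.star_smul,
    Limit.toLimit_smul]

instance : CStarAlgebra S.Limit where
  norm_mul_self_le x := by
    refine Limit.ind (P := fun x => ‖x‖ * ‖x‖ ≤ ‖star x * x‖) x (isClosed_le (by fun_prop) (by fun_prop)) fun y => ?_
    rw [← Limit.toLimit_star, ← Limit.toLimit_mul, Limit.norm_toLimit, Limit.norm_toLimit]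
    exact PreLimit.norm_sq_le y
  star_smul := Limit.star_smul

end CStarSystem

/-! ### Simplicity and traces -/

/-- A C*-algebra is simple if it is nonzero and its only closed two-sided ideals are `0` and the
whole algebra. -/
def IsSimpleCStarAlgebra (A : Type*) [CStarAlgebra A] : Prop :=
  Nontrivial A ∧ ∀ I : TwoSidedIdeal A, IsClosed (I : Set A) → I = ⊥ ∨ I = ⊤

/-- A tracial state: a linear functional `τ` with `τ 1 = 1`, `τ (a* a) ≥ 0` and
`τ (a b) = τ (b a)`. -/
structure IsTracialState {A : Type*} [CStarAlgebra A] (τ : A →ₗ[ℂ] ℂ) : Prop where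
  map_one : τ 1 = 1
  nonneg : ∀ a : A, 0 ≤ (τ (star a * a)).re ∧ (τ (star a * a)).im = 0
  trace : ∀ a b : A, τ (a * b) = τ (b * a)

/-- A unital C*-algebra is monotracial if it has exactly one tracial state. -/
def IsMonotracial (A : Type*) [CStarAlgebra A] : Prop :=
  ∃! τ : A →ₗ[ℂ] ℂ, IsTracialState τ

/-! ### Dimension drop algebras -/

open scoped unitInterval

/-- The dimension drop algebra `Z_{p,q}`: continuous functions `f` from `[0,1]` to
`M_p ⊗ M_q` with `f 0 ∈ M_p ⊗ 1` and `f 1 ∈ 1 ⊗ M_q`. -/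
def dimensionDrop (p q : ℕ) :
    StarSubalgebra ℂ C(I, Matrix (Fin p × Fin q) (Fin p × Fin q) ℂ) where
  carrier := {f | (∃ a : Matrix (Fin p) (Fin p) ℂ, f 0 = a ⊗ₖ (1 : Matrix (Fin q) (Fin q) ℂ)) ∧
    ∃ b : Matrix (Fin q) (Fin q) ℂ, f 1 = (1 : Matrix (Fin p) (Fin p) ℂ) ⊗ₖ b}
  mul_mem' := by
    rintro f g ⟨⟨a, ha⟩, b, hb⟩ ⟨⟨a', ha'⟩, b', hb'⟩
    exact ⟨⟨a * a', by rw [ContinuousMap.mul_apply, ha, ha', ← Matrix.mul_kronecker_mul, mul_one]⟩,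
      b * b', by rw [ContinuousMap.mul_apply, hb, hb', ← Matrix.mul_kronecker_mul, mul_one]⟩
  add_mem' := by
    rintro f g ⟨⟨a, ha⟩, b, hb⟩ ⟨⟨a', ha'⟩, b', hb'⟩
    exact ⟨⟨a + a', by rw [ContinuousMap.add_apply, ha, ha', Matrix.add_kronecker]⟩,
      b + b', by rw [ContinuousMap.add_apply, hb, hb', Matrix.kronecker_add]⟩
  algebraMap_mem' r :=
    ⟨⟨r • 1, by rw [Matrix.smul_kronecker, Matrix.one_kronecker_one, Algebra.algebraMap_eq_smul_one,
        ContinuousMap.smul_apply, ContinuousMap.one_apply]⟩,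
      r • 1, by rw [Matrix.kronecker_smul, Matrix.one_kronecker_one, Algebra.algebraMap_eq_smul_one,
        ContinuousMap.smul_apply, ContinuousMap.one_apply]⟩
  star_mem' := by
    rintro f ⟨⟨a, ha⟩, b, hb⟩
    refine ⟨⟨star a, ?_⟩, star b, ?_⟩
    · rw [ContinuousMap.star_apply, ha, Matrix.star_eq_conjTranspose,
        Matrix.conjTranspose_kronecker, Matrix.conjTranspose_one, Matrix.star_eq_conjTranspose]
    · rw [ContinuousMap.star_apply, hb, Matrix.star_eq_conjTranspose,
        Matrix.conjTranspose_kronecker, Matrix.conjTranspose_one, Matrix.star_eq_conjTranspose]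

instance isClosed_dimensionDrop (p q : ℕ) :
    IsClosed (dimensionDrop p q :
      Set C(I, Matrix (Fin p × Fin q) (Fin p × Fin q) ℂ)) := by
  let L : Matrix (Fin p) (Fin p) ℂ →ₗ[ℂ] Matrix (Fin p × Fin q) (Fin p × Fin q) ℂ :=
    { toFun := fun a => a ⊗ₖ (1 : Matrix (Fin q) (Fin q) ℂ)
      map_add' := fun a a' => Matrix.add_kronecker a a' _
      map_smul' := fun r a => Matrix.smul_kronecker r a _ }
  let R : Matrix (Fin q) (Fin q) ℂ →ₗ[ℂ] Matrix (Fin p × Fin q) (Fin p × Fin q) ℂ :=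
    { toFun := fun b => (1 : Matrix (Fin p) (Fin p) ℂ) ⊗ₖ b
      map_add' := fun b b' => Matrix.kronecker_add _ b b'
      map_smul' := fun r b => Matrix.kronecker_smul r _ b }
  have hL : IsClosed (LinearMap.range L : Set (Matrix (Fin p × Fin q) (Fin p × Fin q) ℂ)) :=
    Submodule.closed_of_finiteDimensional _
  have hR : IsClosed (LinearMap.range R : Set (Matrix (Fin p × Fin q) (Fin p × Fin q) ℂ)) :=
    Submodule.closed_of_finiteDimensional _
  have h0 := hL.preimage
    (continuous_eval_const (F := C(I, Matrix (Fin p × Fin q) (Fin p × Fin q) ℂ)) (0 : I))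
  have h1 := hR.preimage
    (continuous_eval_const (F := C(I, Matrix (Fin p × Fin q) (Fin p × Fin q) ℂ)) (1 : I))
  convert h0.inter h1 using 1
  ext f
  constructor
  · rintro ⟨⟨a, ha⟩, b, hb⟩
    exact ⟨⟨a, ha.symm⟩, b, hb.symm⟩
  · rintro ⟨⟨a, ha⟩, b, hb⟩
    exact ⟨⟨a, ha.symm⟩, b, hb.symm⟩

/-- `Z_{p,q}` as a type; it is a C*-algebra with the pointwise operations and the supremum of the
operator norms of the values. -/
abbrev DimDrop (p q : ℕ) : Type := dimensionDrop p q

section Pattern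

variable {p q : ℕ}

/-- The matrix `c (f 0) ∈ M_p`, determined by `f 0 = c (f 0) ⊗ 1`. -/
def leftEnd [NeZero q] (f : DimDrop p q) : Matrix (Fin p) (Fin p) ℂ :=
  Matrix.of fun i j => f.1 0 (i, 0) (j, 0)

/-- The matrix `c (f 1) ∈ M_q`, determined by `f 1 = 1 ⊗ c (f 1)`. -/
def rightEnd [NeZero p] (f : DimDrop p q) : Matrix (Fin q) (Fin q) ℂ :=
  Matrix.of fun i j => f.1 1 (0, i) (0, j)

theorem leftEnd_kronecker_one [NeZero q] (f : DimDrop p q) :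
    f.1 0 = leftEnd f ⊗ₖ (1 : Matrix (Fin q) (Fin q) ℂ) := by
  obtain ⟨a, ha⟩ := f.2.1
  have : leftEnd f = a := by
    ext i j
    simp [leftEnd, ha]
  rw [this, ha]

theorem one_kronecker_rightEnd [NeZero p] (f : DimDrop p q) :
    f.1 1 = (1 : Matrix (Fin p) (Fin p) ℂ) ⊗ₖ rightEnd f := by
  obtain ⟨b, hb⟩ := f.2.2
  have : rightEnd f = b := by
    ext i j
    simp [rightEnd, hb]
  rw [this, hb]

variable [NeZero p] [NeZero q] {p' q' : ℕ}

/-- The index set of a block diagonal matrix with `a` blocks of size `p`, followed by `k` blocks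
of size `pq` and `b` blocks of size `q`. -/
abbrev BlockIndex (p q a k b : ℕ) : Type :=
  ((Fin a × Fin p) ⊕ (Fin k × (Fin p × Fin q))) ⊕ (Fin b × Fin q)

/-- The block diagonal matrix
`diag[c (f 0), …, c (f 0), f (t₁ s), …, f (t_k s), c (f 1), …, c (f 1)]`, with `a` copies of
`c (f 0)` and `b` copies of `c (f 1)`. -/
def patternMatrix (a b : ℕ) {k : ℕ} (t : Fin k → C(I, I)) (f : DimDrop p q) (s : I) :
    Matrix (BlockIndex p q a k b) (BlockIndex p q a k b) ℂ :=
  Matrix.fromBlocks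
    (Matrix.fromBlocks
      (Matrix.kronecker (1 : Matrix (Fin a) (Fin a) ℂ) (leftEnd f)) 0
      0 (Matrix.of fun x y => if x.1 = y.1 then f.1 (t x.1 s) x.2 y.2 else 0))
    0 0
    (Matrix.kronecker (1 : Matrix (Fin b) (Fin b) ℂ) (rightEnd f))

/-- `t = (t₁, …, t_k)` is an eigenvalue pattern of the `*`-homomorphism `ι`, with remainder
indices `0 ≤ a < q` and `0 ≤ b < p`: up to an identification `e` of the index sets and unitaries
`v s` of size `p'q'`, which need not depend continuously on `s`, the value `ι f s` is the block
diagonal matrix above. -/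
def IsEigenvaluePattern (ι : DimDrop p q →⋆ₐ[ℂ] DimDrop p' q') (a b : ℕ) {k : ℕ}
    (t : Fin k → C(I, I)) : Prop :=
  a < q ∧ b < p ∧
  ∃ (e : BlockIndex p q a k b ≃ Fin p' × Fin q')
    (v : I → Matrix.unitaryGroup (Fin p' × Fin q') ℂ),
    ∀ (f : DimDrop p q) (s : I),
      (ι f).1 s = (v s : Matrix (Fin p' × Fin q') (Fin p' × Fin q') ℂ) *
        Matrix.reindex e e (patternMatrix a b t f s) *
          star (v s : Matrix (Fin p' × Fin q') (Fin p' × Fin q') ℂ)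

/-- A normalized eigenvalue pattern: `t₁ ≤ ⋯ ≤ t_k` pointwise. -/
def IsNormalizedPattern (ι : DimDrop p q →⋆ₐ[ℂ] DimDrop p' q') {k : ℕ}
    (t : Fin k → C(I, I)) : Prop :=
  (∃ a b : ℕ, IsEigenvaluePattern ι a b t) ∧ ∀ (i j : Fin k), i ≤ j → ∀ s : I, t i s ≤ t j s

/-- The variation of a pattern: the maximum of the diameters of the images of `t₁, …, t_k`
(zero if there are none). -/
def patternVariation {k : ℕ} (t : Fin k → C(I, I)) : ℝ≥0∞ :=
  ⨆ i : Fin k, Metric.ediam (Set.range (t i))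

/-- The variation `V(ι)` of a `*`-homomorphism, that is, the variation of its normalized
eigenvalue pattern. The pattern is unique, so that the infimum is over a single value; it is taken
in `[0,∞]` in order that no value be assigned for want of a pattern. -/
def variation (ι : DimDrop p q →⋆ₐ[ℂ] DimDrop p' q') : ℝ≥0∞ :=
  ⨅ (k : ℕ) (t : Fin k → C(I, I)) (_ : IsNormalizedPattern ι t), patternVariation t

end Pattern

end JiangSu

end

open Filter Topology
open scoped Kronecker Matrix.Norms.L2Operator ENNReal

noncomputable section

namespace JiangSu

open scoped unitInterval
open CStarSystem

/-! ### Canonical maps into the inductive limit -/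

namespace CStarSystem

section LimitMaps

variable {A : ℕ → Type*} [∀ n, CStarAlgebra (A n)] {S : CStarSystem A}

/-! Up to a unitary, the value of a connecting map at `f` and `s` depends only on the eigenvalues `t
i s`; both directions exploit this.

Sufficiency. If the variations tend to zero, uniform continuity of `f` makes the values of its image
at a late stage nearly unitarily equivalent to one another (`eventually_nearly_constant`). A bounded
tracial functional on a dimension drop algebra sees only the normalized trace function of an element
(`tracial_eq_centralTrace`). For such an image this function is nearly a scalar, so all tracial
states of the limit agree; one exists as a limit of point traces
(`exists_tracialState_of_ultrafilter`). For simplicity, let `x ≠ 0` lie in an ideal and approximate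
`x* x` by `g* g` with `g` from a late stage. The norms of the values of `g` are nearly constant,
hence bounded below, so a suitable cut-down `(g* g - 2ε)₊` vanishes nowhere and is therefore full
(`exists_isUnit_sum_of_ne_zero`). Compressing `x* x` by it produces an invertible element of the
ideal (`ideal_eq_top_of_full`).

Necessity. Suppose that at infinitely many stages some eigenvalue function moves from below `x` to
above `y`, where `x < z < y`. Limits of point traces at the two parameters are tracial states, hence
equal. Let `h₀ ≤ h₁` be ramps falling from 1 to 0 on `[x, z]` and `[z, y]`. As the eigenvalue
functions are sorted, counting eigenvalues gives `τ h₁ ≤ τ h₀` (`normTrace_ramp_le`), so `τ`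
annihilates `h₁ - h₀`. Tracial states of a simple algebra are faithful
(`IsTracialState.eq_zero_of_isSimple`), so `h₁ - h₀` is zero in the limit. But the eigenvalue
function crosses `z`, where `h₁ - h₀` is 1, so its norm stays at least 1: a contradiction.

The variation is an infimum over normalized patterns. Sufficiency takes a pattern nearly attaining
it; necessity needs some pattern to exist (`exists_isNormalizedPattern`), which follows from
decomposing the representation at each `s` and controlling the dependence on `s` by traces. -/

theorem Limit.toLimit_eq_of_eventually {x y : S.PreLimit}
    (h : ∀ᶠ n in atTop, x.entry n = y.entry n) : x.toLimit = y.toLimit := by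
  have h0 : ‖x - y‖ = 0 := by
    refine tendsto_nhds_unique (PreLimit.tendsto_norm (x - y)) ?_
    refine tendsto_const_nhds.congr' ?_
    filter_upwards [h] with n hn
    have : (x - y).entry n = x.entry n - y.entry n := rfl
    rw [this, hn, sub_self, norm_zero]
  have h1 : (x - y + y).toLimit = (x - y).toLimit + y.toLimit := Limit.toLimit_add _ _
  have h2 : (x - y).toLimit = 0 := by
    rw [← norm_eq_zero, Limit.norm_toLimit, h0]
  rw [sub_add_cancel, h2, zero_add] at h1
  exact h1

/-- The coherent sequence that starts at the index `m` with the value `a`. -/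
def preIncl (S : CStarSystem A) (m : ℕ) (a : A m) : S.PreLimit :=
  ⟨fun n => if h : m ≤ n then S.map h a else 0, m, fun n h => by
    simp only [le_refl, h, dif_pos, S.map_self]⟩

theorem entry_preIncl {m n : ℕ} (h : m ≤ n) (a : A m) :
    (S.preIncl m a).entry n = S.map h a := dif_pos h

/-- The canonical map of the `m`-th algebra of the system to the inductive limit. -/
def incl (S : CStarSystem A) (m : ℕ) : A m →⋆ₐ[ℂ] S.Limit where
  toFun a := (S.preIncl m a).toLimit
  map_one' := by
    change _ = (1 : S.PreLimit).toLimit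
    refine Limit.toLimit_eq_of_eventually ?_
    filter_upwards [eventually_ge_atTop m] with n hn
    rw [entry_preIncl hn, map_one]; rfl
  map_mul' a b := by
    rw [← Limit.toLimit_mul]
    refine Limit.toLimit_eq_of_eventually ?_
    filter_upwards [eventually_ge_atTop m] with n hn
    change _ = (S.preIncl m a).entry n * (S.preIncl m b).entry n
    rw [entry_preIncl hn, entry_preIncl hn, entry_preIncl hn, map_mul]
  map_zero' := by
    change _ = (0 : S.PreLimit).toLimit
    refine Limit.toLimit_eq_of_eventually ?_
    filter_upwards [eventually_ge_atTop m] with n hn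
    rw [entry_preIncl hn, map_zero]; rfl
  map_add' a b := by
    rw [← Limit.toLimit_add]
    refine Limit.toLimit_eq_of_eventually ?_
    filter_upwards [eventually_ge_atTop m] with n hn
    change _ = (S.preIncl m a).entry n + (S.preIncl m b).entry n
    rw [entry_preIncl hn, entry_preIncl hn, entry_preIncl hn, map_add]
  commutes' r := by
    rw [Algebra.algebraMap_eq_smul_one, Algebra.algebraMap_eq_smul_one]
    change _ = r • (1 : S.PreLimit).toLimit
    rw [← Limit.toLimit_smul]
    refine Limit.toLimit_eq_of_eventually ?_
    filter_upwards [eventually_ge_atTop m] with n hn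
    rw [entry_preIncl hn, map_smul, map_one]; rfl
  map_star' a := by
    rw [← Limit.toLimit_star]
    refine Limit.toLimit_eq_of_eventually ?_
    filter_upwards [eventually_ge_atTop m] with n hn
    change _ = star ((S.preIncl m a).entry n)
    rw [entry_preIncl hn, entry_preIncl hn, map_star]

theorem incl_apply (m : ℕ) (a : A m) : S.incl m a = (S.preIncl m a).toLimit := rfl

theorem incl_map {m n : ℕ} (h : m ≤ n) (a : A m) : S.incl n (S.map h a) = S.incl m a := by
  refine Limit.toLimit_eq_of_eventually ?_
  filter_upwards [eventually_ge_atTop n] with k hk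
  rw [entry_preIncl hk, entry_preIncl (h.trans hk), S.map_map]

theorem exists_incl_eq (x : S.PreLimit) : ∃ (m : ℕ) (a : A m), S.incl m a = x.toLimit := by
  obtain ⟨m, hm⟩ := x.2
  refine ⟨m, x.1 m, Limit.toLimit_eq_of_eventually ?_⟩
  filter_upwards [eventually_ge_atTop m] with n hn
  rw [entry_preIncl hn, hm]; rfl

theorem Limit.ind_incl {P : S.Limit → Prop} (x : S.Limit) (hc : IsClosed {y | P y})
    (h : ∀ (m : ℕ) (a : A m), P (S.incl m a)) : P x := by
  refine Limit.ind x hc fun y => ?_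
  obtain ⟨m, a, ha⟩ := exists_incl_eq y
  exact ha ▸ h m a

theorem tendsto_norm_preIncl (m : ℕ) (a : A m) :
    Tendsto (fun n => ‖(S.preIncl m a).entry n‖) atTop (𝓝 ‖S.incl m a‖) := by
  rw [incl_apply, Limit.norm_toLimit]
  exact PreLimit.tendsto_norm _

/-- The norms converge along all stages, so a lower bound along any finer filter passes to the
limit; the necessity argument controls only the stages in an ultrafilter. -/
theorem le_norm_incl {m : ℕ} {a : A m} {r : ℝ} {l : Filter ℕ} [l.NeBot] (hl : l ≤ atTop)
    (h : ∀ᶠ n in l, ∃ hmn : m ≤ n, r ≤ ‖S.map hmn a‖) : r ≤ ‖S.incl m a‖ := by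
  refine ge_of_tendsto ((tendsto_norm_preIncl m a).mono_left hl) (h.mono fun n hn => ?_)
  obtain ⟨hmn, hr⟩ := hn
  rwa [entry_preIncl hmn]

theorem incl_star_mul_self_add {m : ℕ} {a b c : A m} (h : star a * a + b = c) :
    star (S.incl m a) * S.incl m a + S.incl m b = S.incl m c := by
  rw [← h, map_add, map_mul, map_star]

end LimitMaps

end CStarSystem

/-! ### Elements and quotients of dimension drop algebras -/

section Elements

variable {p q : ℕ}

theorem DimDrop.ext {f g : DimDrop p q} (h : ∀ s, f.1 s = g.1 s) : f = g :=
  Subtype.ext (ContinuousMap.ext h)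

theorem DimDrop.mul_apply (f g : DimDrop p q) (s : I) : (f * g).1 s = f.1 s * g.1 s := rfl

theorem DimDrop.add_apply (f g : DimDrop p q) (s : I) : (f + g).1 s = f.1 s + g.1 s := rfl

theorem DimDrop.sub_apply (f g : DimDrop p q) (s : I) : (f - g).1 s = f.1 s - g.1 s := rfl

theorem DimDrop.star_apply (f : DimDrop p q) (s : I) : (star f).1 s = star (f.1 s) := rfl

theorem DimDrop.one_apply (s : I) : (1 : DimDrop p q).1 s = 1 := rfl

theorem DimDrop.smul_apply (r : ℂ) (f : DimDrop p q) (s : I) : (r • f).1 s = r • f.1 s := rfl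

theorem DimDrop.norm_apply_le (f : DimDrop p q) (s : I) : ‖f.1 s‖ ≤ ‖f‖ :=
  f.1.norm_coe_le_norm s

theorem DimDrop.norm_le {f : DimDrop p q} {r : ℝ} (hr : 0 ≤ r) (h : ∀ s, ‖f.1 s‖ ≤ r) :
    ‖f‖ ≤ r := (ContinuousMap.norm_le _ hr).2 h

theorem DimDrop.map_sub {B : Type*} [Ring B] [StarRing B] [Algebra ℂ B]
    (Φ : DimDrop p q →⋆ₐ[ℂ] B) (f g : DimDrop p q) : Φ (f - g) = Φ f - Φ g :=
  _root_.map_sub Φ f g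

theorem DimDrop.dist_eq (f g : DimDrop p q) : dist f g = ‖f - g‖ := dist_eq_norm f g

theorem DimDrop.dist_zero (f : DimDrop p q) : dist f 0 = ‖f‖ := dist_zero_right f

theorem DimDrop.norm_map_le {B : Type*} [CStarAlgebra B] (Φ : DimDrop p q →⋆ₐ[ℂ] B)
    (f : DimDrop p q) : ‖Φ f‖ ≤ ‖f‖ :=
  NonUnitalStarAlgHom.norm_apply_le Φ f

theorem DimDrop.continuous_hom {B : Type*} [CStarAlgebra B] (Φ : DimDrop p q →⋆ₐ[ℂ] B) :
    Continuous Φ :=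
  (LipschitzWith.of_dist_le_mul (K := 1) fun f g => by
    rw [DimDrop.dist_eq, dist_eq_norm, ← DimDrop.map_sub, NNReal.coe_one, one_mul]
    exact DimDrop.norm_map_le Φ _).continuous

/-- Evaluation at a point of the interval. -/
def evalHom (s : I) : DimDrop p q →⋆ₐ[ℂ] Matrix (Fin p × Fin q) (Fin p × Fin q) ℂ where
  toFun f := f.1 s
  map_one' := rfl
  map_mul' _ _ := rfl
  map_zero' := rfl
  map_add' _ _ := rfl
  commutes' _ := rfl
  map_star' _ := rfl

theorem evalHom_apply (s : I) (f : DimDrop p q) : evalHom s f = f.1 s := rfl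

/-- The function `s ↦ g s • A`, as an element of the dimension drop algebra. -/
def elt (g : C(I, ℂ)) (A : Matrix (Fin p × Fin q) (Fin p × Fin q) ℂ)
    (h0 : g 0 = 0 ∨ ∃ a : Matrix (Fin p) (Fin p) ℂ, A = a ⊗ₖ (1 : Matrix (Fin q) (Fin q) ℂ))
    (h1 : g 1 = 0 ∨ ∃ b : Matrix (Fin q) (Fin q) ℂ, A = (1 : Matrix (Fin p) (Fin p) ℂ) ⊗ₖ b) :
    DimDrop p q :=
  ⟨⟨fun s => g s • A, by fun_prop⟩, by
    constructor
    · rcases h0 with h | ⟨a, rfl⟩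
      · exact ⟨0, by simp [h]⟩
      · exact ⟨g 0 • a, by simp [Matrix.smul_kronecker]⟩
    · rcases h1 with h | ⟨b, rfl⟩
      · exact ⟨0, by simp [h]⟩
      · exact ⟨g 1 • b, by simp [Matrix.kronecker_smul]⟩⟩

/-- The central element `s ↦ g s • 1`. -/
def central (g : C(I, ℂ)) : DimDrop p q :=
  elt g 1 (Or.inr ⟨1, by simp⟩) (Or.inr ⟨1, by simp⟩)

theorem central_apply (g : C(I, ℂ)) (s : I) : (central g : DimDrop p q).1 s = g s • 1 := rfl

theorem central_mul_comm (g : C(I, ℂ)) (f : DimDrop p q) : central g * f = f * central g := by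
  refine DimDrop.ext fun s => ?_
  simp [central_apply]

/-- The element `s ↦ g s • A` for a function vanishing at both ends. -/
def innerElt (g : C(I, ℂ)) (h0 : g 0 = 0) (h1 : g 1 = 0)
    (A : Matrix (Fin p × Fin q) (Fin p × Fin q) ℂ) : DimDrop p q :=
  elt g A (Or.inl h0) (Or.inl h1)

/-- The element `s ↦ g s • (a ⊗ 1)` for a function vanishing at `1`. -/
def leftElt (g : C(I, ℂ)) (h1 : g 1 = 0) (a : Matrix (Fin p) (Fin p) ℂ) : DimDrop p q :=
  elt g (a ⊗ₖ 1) (Or.inr ⟨a, rfl⟩) (Or.inl h1)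

/-- The element `s ↦ g s • (1 ⊗ b)` for a function vanishing at `0`. -/
def rightElt (g : C(I, ℂ)) (h0 : g 0 = 0) (b : Matrix (Fin q) (Fin q) ℂ) : DimDrop p q :=
  elt g (1 ⊗ₖ b) (Or.inl h0) (Or.inr ⟨b, rfl⟩)

theorem innerElt_apply (g : C(I, ℂ)) (h0 h1) (A : Matrix (Fin p × Fin q) (Fin p × Fin q) ℂ)
    (s : I) : (innerElt g h0 h1 A : DimDrop p q).1 s = g s • A := rfl

theorem leftElt_apply (g : C(I, ℂ)) (h1) (a : Matrix (Fin p) (Fin p) ℂ) (s : I) :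
    (leftElt g h1 a : DimDrop p q).1 s = g s • (a ⊗ₖ 1) := rfl

theorem rightElt_apply (g : C(I, ℂ)) (h0) (b : Matrix (Fin q) (Fin q) ℂ) (s : I) :
    (rightElt g h0 b : DimDrop p q).1 s = g s • (1 ⊗ₖ b) := rfl

theorem leftEnd_eq [NeZero q] {f : DimDrop p q} {a : Matrix (Fin p) (Fin p) ℂ}
    (h : f.1 0 = a ⊗ₖ (1 : Matrix (Fin q) (Fin q) ℂ)) : leftEnd f = a := by
  ext i j
  simp [leftEnd, h]

theorem rightEnd_eq [NeZero p] {f : DimDrop p q} {b : Matrix (Fin q) (Fin q) ℂ}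
    (h : f.1 1 = (1 : Matrix (Fin p) (Fin p) ℂ) ⊗ₖ b) : rightEnd f = b := by
  ext i j
  simp [rightEnd, h]

/-- The map `f ↦ c (f 0)`. -/
def leftEndHom [NeZero q] : DimDrop p q →⋆ₐ[ℂ] Matrix (Fin p) (Fin p) ℂ where
  toFun := leftEnd
  map_one' := leftEnd_eq (by simp)
  map_mul' f g := leftEnd_eq (by
    rw [DimDrop.mul_apply, leftEnd_kronecker_one f, leftEnd_kronecker_one g,
      ← Matrix.mul_kronecker_mul, mul_one])
  map_zero' := leftEnd_eq (by simp)
  map_add' f g := leftEnd_eq (by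
    rw [DimDrop.add_apply, leftEnd_kronecker_one f, leftEnd_kronecker_one g,
      Matrix.add_kronecker])
  commutes' r := leftEnd_eq (by
    rw [Algebra.algebraMap_eq_smul_one, Algebra.algebraMap_eq_smul_one, DimDrop.smul_apply,
      DimDrop.one_apply, Matrix.smul_kronecker, Matrix.one_kronecker_one])
  map_star' f := leftEnd_eq (by
    rw [DimDrop.star_apply, leftEnd_kronecker_one f, Matrix.star_eq_conjTranspose,
      Matrix.conjTranspose_kronecker, Matrix.conjTranspose_one, Matrix.star_eq_conjTranspose])

/-- The map `f ↦ c (f 1)`. -/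
def rightEndHom [NeZero p] : DimDrop p q →⋆ₐ[ℂ] Matrix (Fin q) (Fin q) ℂ where
  toFun := rightEnd
  map_one' := rightEnd_eq (by simp)
  map_mul' f g := rightEnd_eq (by
    rw [DimDrop.mul_apply, one_kronecker_rightEnd f, one_kronecker_rightEnd g,
      ← Matrix.mul_kronecker_mul, mul_one])
  map_zero' := rightEnd_eq (by simp)
  map_add' f g := rightEnd_eq (by
    rw [DimDrop.add_apply, one_kronecker_rightEnd f, one_kronecker_rightEnd g,
      Matrix.kronecker_add])
  commutes' r := rightEnd_eq (by
    rw [Algebra.algebraMap_eq_smul_one, Algebra.algebraMap_eq_smul_one, DimDrop.smul_apply,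
      DimDrop.one_apply, Matrix.kronecker_smul, Matrix.one_kronecker_one])
  map_star' f := rightEnd_eq (by
    rw [DimDrop.star_apply, one_kronecker_rightEnd f, Matrix.star_eq_conjTranspose,
      Matrix.conjTranspose_kronecker, Matrix.conjTranspose_one, Matrix.star_eq_conjTranspose])

theorem evalHom_surjective {x : I} (h0 : x ≠ 0) (h1 : x ≠ 1) :
    Function.Surjective (evalHom x : DimDrop p q →⋆ₐ[ℂ] _) := by
  intro A
  have hx : ((x : ℝ) * (1 - x) : ℂ) ≠ 0 := by
    refine mul_ne_zero ?_ (sub_ne_zero.2 ?_)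
    · exact_mod_cast fun h : (x : ℝ) = 0 => h0 (Subtype.ext h)
    · exact_mod_cast fun h : (1 : ℝ) = x => h1 (Subtype.ext h.symm)
  refine ⟨innerElt ⟨fun s => ((s : ℝ) * (1 - (s : ℝ)) : ℂ), by fun_prop⟩ (by simp) (by simp)
    (((x : ℝ) * (1 - x) : ℂ)⁻¹ • A), ?_⟩
  rw [evalHom_apply, innerElt_apply, ContinuousMap.coe_mk, smul_smul, mul_inv_cancel₀ hx, one_smul]

theorem leftEndHom_surjective [NeZero q] :
    Function.Surjective (leftEndHom : DimDrop p q →⋆ₐ[ℂ] _) := fun a =>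
  ⟨leftElt ⟨fun s => (1 - (s : ℝ) : ℂ), by fun_prop⟩ (by simp) a,
    leftEnd_eq (by simp [leftElt_apply])⟩

theorem rightEndHom_surjective [NeZero p] :
    Function.Surjective (rightEndHom : DimDrop p q →⋆ₐ[ℂ] _) := fun b =>
  ⟨rightElt ⟨fun s => ((s : ℝ) : ℂ), by fun_prop⟩ (by simp) b,
    rightEnd_eq (by simp [rightElt_apply])⟩

end Elements

/-! ### Finite-dimensional representations on one central eigenspace -/

section Representation

variable {p q : ℕ}

/-- The canonical generator `s ↦ s • 1` of the centre. -/
def position : DimDrop p q := central ⟨fun s => ((s : ℝ) : ℂ), by fun_prop⟩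

theorem position_apply (s : I) : (position : DimDrop p q).1 s = ((s : ℝ) : ℂ) • 1 := rfl

theorem star_position : star (position : DimDrop p q) = position := by
  refine DimDrop.ext fun s => ?_
  simp [position_apply]

theorem position_mul_comm (f : DimDrop p q) : position * f = f * position :=
  central_mul_comm _ f

/-- The central function `1 - (s - x)²` is 1 at `x` and lies in `[0,1)` elsewhere. Its powers tend
to 0 uniformly away from `x`, and near `x` the factor `f` is itself small. -/
theorem tendsto_mul_pow_sub_sq (f : DimDrop p q) {x : I} (hf : f.1 x = 0) :
    Tendsto (fun M : ℕ => f * (1 - (position - algebraMap ℂ _ ((x : ℝ) : ℂ)) ^ 2) ^ M) atTop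
      (𝓝 0) := by
  have key : ∀ (M : ℕ) (s : I),
      (f * (1 - (position - algebraMap ℂ (DimDrop p q) ((x : ℝ) : ℂ)) ^ 2) ^ M).1 s =
        (((1 - ((s : ℝ) - x) ^ 2) ^ M : ℝ) : ℂ) • f.1 s := by
    intro M s
    have h1 : (1 - (position - algebraMap ℂ (DimDrop p q) ((x : ℝ) : ℂ)) ^ 2).1 s =
        ((1 - ((s : ℝ) - x) ^ 2 : ℝ) : ℂ) • (1 : Matrix (Fin p × Fin q) (Fin p × Fin q) ℂ) := by
      change 1 - (((s : ℝ) : ℂ) • (1 : Matrix (Fin p × Fin q) (Fin p × Fin q) ℂ) -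
        algebraMap ℂ _ ((x : ℝ) : ℂ)) ^ 2 = _
      rw [Algebra.algebraMap_eq_smul_one, ← sub_smul, smul_pow, one_pow]
      push_cast
      rw [sub_smul, one_smul]
    rw [DimDrop.mul_apply, ← evalHom_apply s (_ ^ M), map_pow, evalHom_apply, h1, smul_pow, one_pow,
      mul_smul_comm, mul_one, Complex.ofReal_pow]
  rw [Metric.tendsto_atTop]
  intro ε hε
  have hcont : Continuous fun s => ‖f.1 s‖ := by fun_prop
  obtain ⟨δ, hδ, hδf⟩ := Metric.continuous_iff.1 hcont x (ε / 2) (by positivity)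
  have hr : ∀ s : I, |(s : ℝ) - x| ≤ 1 := fun s => by
    rw [abs_le]; constructor <;> linarith [s.2.1, s.2.2, x.2.1, x.2.2]
  have hr0 : ∀ s : I, 0 ≤ 1 - ((s : ℝ) - x) ^ 2 := fun s => by
    have := (sq_le_one_iff_abs_le_one _).2 (hr s); linarith
  have hr1 : ∀ s : I, 1 - ((s : ℝ) - x) ^ 2 ≤ 1 := fun s => by nlinarith [sq_nonneg ((s : ℝ) - x)]
  -- Capping at 1 keeps `1 - δ' ^ 2` in `[0,1)`.
  set δ' := min δ 1
  have hδ' : 0 < δ' := lt_min hδ one_pos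
  have hlim : Tendsto (fun M : ℕ => (1 - δ' ^ 2) ^ M * ‖f‖) atTop (𝓝 (0 * ‖f‖)) :=
    (tendsto_pow_atTop_nhds_zero_of_lt_one
      (by nlinarith [min_le_right δ 1]) (by nlinarith)).mul_const _
  rw [zero_mul] at hlim
  obtain ⟨N, hN⟩ := (Metric.tendsto_atTop.1 hlim) (ε / 2) (by positivity)
  refine ⟨N, fun M hM => ?_⟩
  rw [DimDrop.dist_zero]
  refine lt_of_le_of_lt (DimDrop.norm_le (r := ε / 2) (by positivity) fun s => ?_) (by linarith)
  rw [key, norm_smul, Complex.norm_real, Real.norm_of_nonneg (pow_nonneg (hr0 s) _)]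
  by_cases hs : dist s x < δ
  · have h1 := hδf s hs
    rw [hf, norm_zero, dist_zero_right, norm_norm] at h1
    exact (mul_le_of_le_one_left (norm_nonneg _) (pow_le_one₀ (hr0 s) (hr1 s))).trans h1.le
  · have h2 : δ' ≤ |(s : ℝ) - x| := by
      refine (min_le_left _ _).trans ?_
      rw [Subtype.dist_eq, Real.dist_eq] at hs
      exact not_lt.1 hs
    have h3 : δ' ^ 2 ≤ ((s : ℝ) - x) ^ 2 := by
      rw [← sq_abs ((s : ℝ) - x)]; gcongr
    have h4 := hN M hM
    rw [dist_zero_right] at h4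
    calc _ ≤ (1 - δ' ^ 2) ^ M * ‖f‖ := by
          gcongr
          · exact pow_nonneg (by nlinarith [min_le_right δ 1]) _
          · exact hr0 s
          · exact DimDrop.norm_apply_le f s
      _ ≤ ε / 2 := (le_abs_self _).trans h4.le

variable {H : Type*} [NormedAddCommGroup H] [InnerProductSpace ℂ H] [CompleteSpace H]

/-- The image of `1 - (position - x)²` fixes `v`, so multiplying `f` by its powers does not change
`Φ f v`, while these products tend to 0. Hence on the eigenspace at `x` only the value of `f` at `x`
matters. -/
theorem apply_eq_zero_of_apply_eq_zero (Φ : DimDrop p q →⋆ₐ[ℂ] (H →L[ℂ] H)) {x : I} {v : H}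
    (hv : Φ position v = ((x : ℝ) : ℂ) • v) {f : DimDrop p q} (hf : f.1 x = 0) : Φ f v = 0 := by
  have hcΦ : Continuous Φ := DimDrop.continuous_hom Φ
  have h1 : Tendsto (fun M : ℕ => Φ (f * (1 - (position - algebraMap ℂ _ ((x : ℝ) : ℂ)) ^ 2) ^ M) v)
      atTop (𝓝 (Φ 0 v)) :=
    (((ContinuousLinearMap.apply ℂ H v).continuous.comp hcΦ).tendsto 0).comp
      (tendsto_mul_pow_sub_sq f hf)
  have h2 : ∀ M : ℕ,
      Φ (f * (1 - (position - algebraMap ℂ _ ((x : ℝ) : ℂ)) ^ 2) ^ M) v = Φ f v := by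
    have h3 : Φ (1 - (position - algebraMap ℂ _ ((x : ℝ) : ℂ)) ^ 2) v = v := by
      rw [DimDrop.map_sub, map_pow, DimDrop.map_sub, AlgHomClass.commutes]
      simp [pow_two, hv, Algebra.algebraMap_eq_smul_one]
    intro M
    induction M with
    | zero => simp
    | succ M ih =>
      rw [pow_succ, ← mul_assoc, map_mul, mul_apply_eq_comp, h3, ih]
  simp only [h2] at h1
  rw [map_zero] at h1
  exact tendsto_nhds_unique tendsto_const_nhds h1

/-- The eigenspaces of the canonical central element. -/
def centralEigenspace (Φ : DimDrop p q →⋆ₐ[ℂ] (H →L[ℂ] H)) (x : I) : Submodule ℂ H where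
  carrier := {v | Φ position v = ((x : ℝ) : ℂ) • v}
  zero_mem' := by simp
  add_mem' {v w} hv hw := by
    rw [Set.mem_ofPred_eq] at *; rw [map_add, hv, hw, smul_add]
  smul_mem' r v hv := by
    rw [Set.mem_ofPred_eq] at *; rw [map_smul, hv, smul_comm]

theorem mem_centralEigenspace {Φ : DimDrop p q →⋆ₐ[ℂ] (H →L[ℂ] H)} {x : I} {v : H} :
    v ∈ centralEigenspace Φ x ↔ Φ position v = ((x : ℝ) : ℂ) • v := Iff.rfl

/-- A representation whose restriction to an eigenspace of the centre factors through a full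
matrix algebra is there a multiple of the standard representation. -/
theorem exists_orthonormal_centralEigenspace [FiniteDimensional ℂ H]
    (Φ : DimDrop p q →⋆ₐ[ℂ] (H →L[ℂ] H)) (x : I)
    {D : Type} [Fintype D] [DecidableEq D] [Nonempty D] (ψ : DimDrop p q →⋆ₐ[ℂ] Matrix D D ℂ)
    (hψ : Function.Surjective ψ) (hψx : ∀ f, ψ f = 0 → f.1 x = 0) :
    ∃ (m : ℕ) (u : Fin m × D → H), Orthonormal ℂ u ∧ (∀ i, u i ∈ centralEigenspace Φ x) ∧
      centralEigenspace Φ x ≤ Submodule.span ℂ (Set.range u) ∧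
      ∀ f j i, Φ f (u (j, i)) = ∑ k, ψ f k i • u (j, k) := by
  classical
  obtain ⟨o⟩ := ‹Nonempty D›
  choose e he using fun i j : D => hψ (Matrix.single i j 1)
  have inv : ∀ f : DimDrop p q, ∀ v ∈ centralEigenspace Φ x, Φ f v ∈ centralEigenspace Φ x := by
    intro f v hv
    rw [mem_centralEigenspace] at *
    rw [← mul_apply_eq_comp, ← map_mul, position_mul_comm, map_mul,
      mul_apply_eq_comp, hv, map_smul]
  -- By `hψx` the kernel of `ψ` acts as zero on the eigenspace, so there `Φ` behaves as a
  -- representation of the matrix algebra, and the lifts `e i j` behave as matrix units.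
  have congr : ∀ f g : DimDrop p q, ψ f = ψ g → ∀ v ∈ centralEigenspace Φ x, Φ f v = Φ g v := by
    intro f g h v hv
    have h1 := apply_eq_zero_of_apply_eq_zero Φ (mem_centralEigenspace.1 hv)
      (hψx (f - g) (by rw [DimDrop.map_sub, h, sub_self]))
    rwa [DimDrop.map_sub, sub_apply, sub_eq_zero] at h1
  -- The range of the minimal projection `e o o` in the eigenspace is the multiplicity space; the `e
  -- i o` carry an orthonormal basis of it to the other coordinates.
  let F : Submodule ℂ H := centralEigenspace Φ x ⊓ LinearMap.eqLocus (Φ (e o o)).toLinearMap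
    LinearMap.id
  have hF : ∀ v, v ∈ F ↔ v ∈ centralEigenspace Φ x ∧ Φ (e o o) v = v := fun v => Iff.rfl
  let b := stdOrthonormalBasis ℂ F
  let u : Fin (Module.finrank ℂ F) × D → H := fun ji => Φ (e ji.2 o) (b ji.1)
  have hbE : ∀ j, (b j : H) ∈ centralEigenspace Φ x := fun j => ((hF _).1 (b j).2).1
  have hb : ∀ j, Φ (e o o) (b j) = b j := fun j => ((hF _).1 (b j).2).2
  refine ⟨_, u, ?_, fun i => inv _ _ (hbE _), fun v hv => ?_, fun f j i => ?_⟩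
  · rw [orthonormal_iff_ite]
    rintro ⟨j, i⟩ ⟨j', i'⟩
    change inner ℂ (Φ (e i o) (b j)) (Φ (e i' o) (b j')) = _
    rw [← ContinuousLinearMap.adjoint_inner_right, ← ContinuousLinearMap.star_eq_adjoint,
      ← map_star, ← mul_apply_eq_comp, ← map_mul]
    by_cases hi : i = i'
    · subst hi
      rw [congr _ (e o o) _ _ (hbE j'), hb, ← Submodule.coe_inner,
        orthonormal_iff_ite.1 b.orthonormal]
      · simp
      · rw [map_mul, map_star, he, he, Matrix.star_eq_conjTranspose, Matrix.conjTranspose_single,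
          Matrix.single_mul_single_same]
        simp
    · rw [congr _ 0 _ _ (hbE j'), map_zero, zero_apply, inner_zero_right,
        if_neg (by simp [hi])]
      rw [map_mul, map_star, he, he, Matrix.star_eq_conjTranspose, Matrix.conjTranspose_single,
        Matrix.single_mul_single_of_ne _ _ _ _ hi, map_zero]
  -- The identity is the sum of the `e i o * e o i`, and `e o i` maps the eigenspace into `F`.
  · have h1 : v = ∑ i, Φ (e i o) (Φ (e o i) v) := by
      conv_lhs => rw [← ContinuousLinearMap.id_apply (R₁ := ℂ) v, ← ContinuousLinearMap.one_def, ← map_one Φ]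
      rw [congr 1 (∑ i, e i o * e o i) _ v hv]
      · simp [map_sum]
      · rw [map_one, map_sum, ← Matrix.sum_single_one]
        simp [he]
    rw [h1]
    refine Submodule.sum_mem _ fun i _ => ?_
    have h2 : Φ (e o i) v ∈ F := by
      refine (hF _).2 ⟨inv _ _ hv, ?_⟩
      rw [← mul_apply_eq_comp, ← map_mul]
      exact congr _ _ (by simp [he]) v hv
    have h3 := congrArg (Subtype.val) (b.sum_repr ⟨_, h2⟩)
    rw [Submodule.coe_sum] at h3
    change _ = Φ (e o i) v at h3
    rw [← h3, map_sum]
    refine Submodule.sum_mem _ fun j _ => ?_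
    rw [Submodule.coe_smul, map_smul]
    exact Submodule.smul_mem _ _ (Submodule.subset_span ⟨(j, i), rfl⟩)
  · change Φ f (Φ (e i o) (b j)) = ∑ k, ψ f k i • Φ (e k o) (b j)
    rw [← mul_apply_eq_comp, ← map_mul,
      congr _ (∑ k, ψ f k i • e k o) _ _ (hbE j)]
    · simp [map_sum]
    · rw [map_mul, map_sum, he]
      ext a c
      by_cases hc : c = o
      · subst hc
        simp [he, Matrix.mul_apply, Matrix.sum_apply, Matrix.single_apply]
      · have hc' : o ≠ c := fun h => hc h.symm
        simp [he, Matrix.mul_apply, Matrix.sum_apply, hc']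

end Representation

/-! ### Block diagonal bases and their normalization -/

section BlockBasis

variable {p q : ℕ} [NeZero p] [NeZero q]
variable {A K B A' K' B' : Type} [DecidableEq A] [DecidableEq K] [DecidableEq B]
  [DecidableEq A'] [DecidableEq K'] [DecidableEq B']

/-- The block diagonal matrix with blocks `c (f 0)` indexed by `A`, `f (x k)` indexed by `k : K`,
and `c (f 1)` indexed by `B`. -/
def blockMatrix (A B : Type) [DecidableEq A] [DecidableEq B] (x : K → I) (f : DimDrop p q) :
    Matrix (((A × Fin p) ⊕ (K × (Fin p × Fin q))) ⊕ (B × Fin q))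
      (((A × Fin p) ⊕ (K × (Fin p × Fin q))) ⊕ (B × Fin q)) ℂ :=
  Matrix.fromBlocks
    (Matrix.fromBlocks
      (Matrix.kronecker (1 : Matrix A A ℂ) (leftEnd f)) 0
      0 (Matrix.of fun y z => if y.1 = z.1 then f.1 (x y.1) y.2 z.2 else 0))
    0 0
    (Matrix.kronecker (1 : Matrix B B ℂ) (rightEnd f))

theorem blockMatrix_eq_patternMatrix (a b : ℕ) {k : ℕ} (t : Fin k → C(I, I)) (f : DimDrop p q)
    (s : I) : blockMatrix (Fin a) (Fin b) (fun i => t i s) f = patternMatrix a b t f s := rfl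

theorem blockMatrix_rename (eA : A' ≃ A) (eK : K' ≃ K) (eB : B' ≃ B) (x : K → I)
    (f : DimDrop p q) (r c : ((A' × Fin p) ⊕ (K' × (Fin p × Fin q))) ⊕ (B' × Fin q)) :
    blockMatrix A B x f
      (Equiv.sumCongr (Equiv.sumCongr (eA.prodCongr (.refl _)) (eK.prodCongr (.refl _)))
        (eB.prodCongr (.refl _)) r)
      (Equiv.sumCongr (Equiv.sumCongr (eA.prodCongr (.refl _)) (eK.prodCongr (.refl _)))
        (eB.prodCongr (.refl _)) c) = blockMatrix A' B' (x ∘ eK) f r c := by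
  rcases r with (⟨r, i⟩ | ⟨r, i⟩) | ⟨r, i⟩ <;> rcases c with (⟨c, j⟩ | ⟨c, j⟩) | ⟨c, j⟩ <;>
    simp [blockMatrix, Matrix.one_apply]

/-- Regrouping `q` copies of `c (f 0)` to `f 0` and `p` copies of `c (f 1)` to `f 1`. -/
def regroupEquiv (p q : ℕ) (A B K K₀ K₁ : Type) :
    ((A × Fin p) ⊕ ((K ⊕ K₀ ⊕ K₁) × (Fin p × Fin q))) ⊕ (B × Fin q) ≃
      (((A ⊕ K₀ × Fin q) × Fin p) ⊕ (K × (Fin p × Fin q))) ⊕ ((B ⊕ K₁ × Fin p) × Fin q) where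
  toFun
    | .inl (.inl (a, i)) => .inl (.inl (.inl a, i))
    | .inl (.inr (.inl k, ij)) => .inl (.inr (k, ij))
    | .inl (.inr (.inr (.inl k), (i, j))) => .inl (.inl (.inr (k, j), i))
    | .inl (.inr (.inr (.inr k), (i, j))) => .inr (.inr (k, i), j)
    | .inr (b, j) => .inr (.inl b, j)
  invFun
    | .inl (.inl (.inl a, i)) => .inl (.inl (a, i))
    | .inl (.inr (k, ij)) => .inl (.inr (.inl k, ij))
    | .inl (.inl (.inr (k, j), i)) => .inl (.inr (.inr (.inl k), (i, j)))
    | .inr (.inr (k, i), j) => .inl (.inr (.inr (.inr k), (i, j)))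
    | .inr (.inl b, j) => .inr (b, j)
  left_inv := by
    rintro ((⟨a, i⟩ | ⟨k | k | k, i, j⟩) | ⟨b, j⟩) <;> rfl
  right_inv := by
    rintro ((⟨a | ⟨k, j⟩, i⟩ | ⟨k, i, j⟩) | ⟨b | ⟨k, i⟩, j⟩) <;> rfl

/-- Since `f 0 = c (f 0) ⊗ 1`, a block `f 0` is `q` copies of `c (f 0)`, labelled by the second
tensor coordinate; dually, `f 1` is `p` copies of `c (f 1)`, labelled by the first. -/
theorem blockMatrix_regroup {K₀ K₁ : Type} [DecidableEq K₀] [DecidableEq K₁] (x : K → I)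
    (f : DimDrop p q)
    (r c : ((A × Fin p) ⊕ ((K ⊕ K₀ ⊕ K₁) × (Fin p × Fin q))) ⊕ (B × Fin q)) :
    blockMatrix (A ⊕ K₀ × Fin q) (B ⊕ K₁ × Fin p) x f
      (regroupEquiv p q A B K K₀ K₁ r) (regroupEquiv p q A B K K₀ K₁ c) =
      blockMatrix A B (Sum.elim x (Sum.elim (fun _ => 0) fun _ => 1)) f r c := by
  have h0 := leftEnd_kronecker_one f
  have h1 := one_kronecker_rightEnd f
  rcases r with (⟨r, i⟩ | ⟨r | r | r, i, j⟩) | ⟨r, i⟩ <;>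
    rcases c with (⟨c, i'⟩ | ⟨c | c | c, i', j'⟩) | ⟨c, i'⟩ <;>
    simp [blockMatrix, regroupEquiv, Matrix.one_apply, h0, h1] <;>
    grind

variable {H : Type*} [NormedAddCommGroup H] [InnerProductSpace ℂ H] [CompleteSpace H]
  [Fintype A] [Fintype K] [Fintype B] [Fintype A'] [Fintype K'] [Fintype B']

/-- There is an orthonormal basis in which the representation is block diagonal. -/
def HasBlockBasis (Φ : DimDrop p q →⋆ₐ[ℂ] (H →L[ℂ] H)) (A B : Type) [DecidableEq A]
    [DecidableEq B] [Fintype A] [Fintype B] (x : K → I) : Prop :=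
  ∃ u : OrthonormalBasis (((A × Fin p) ⊕ (K × (Fin p × Fin q))) ⊕ (B × Fin q)) ℂ H,
    ∀ f c, Φ f (u c) = ∑ r, blockMatrix A B x f r c • u r

theorem HasBlockBasis.transport {Φ : DimDrop p q →⋆ₐ[ℂ] (H →L[ℂ] H)} {x : K → I} {x' : K' → I}
    (h : HasBlockBasis Φ A B x)
    (φ : ((A' × Fin p) ⊕ (K' × (Fin p × Fin q))) ⊕ (B' × Fin q) ≃
      ((A × Fin p) ⊕ (K × (Fin p × Fin q))) ⊕ (B × Fin q))
    (hφ : ∀ f r c, blockMatrix A B x f (φ r) (φ c) = blockMatrix A' B' x' f r c) :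
    HasBlockBasis Φ A' B' x' := by
  obtain ⟨u, hu⟩ := h
  refine ⟨u.reindex φ.symm, fun f c => ?_⟩
  simp only [OrthonormalBasis.reindex_apply, Equiv.symm_symm, hu, ← hφ]
  exact (Equiv.sum_comp φ fun r => blockMatrix A B x f r (φ c) • u r).symm

theorem HasBlockBasis.rename {Φ : DimDrop p q →⋆ₐ[ℂ] (H →L[ℂ] H)} {x : K → I}
    (h : HasBlockBasis Φ A B x) (eA : A' ≃ A) (eK : K' ≃ K) (eB : B' ≃ B) :
    HasBlockBasis Φ A' B' (x ∘ eK) :=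
  h.transport _ fun f r c => blockMatrix_rename eA eK eB x f r c

theorem HasBlockBasis.regroup {Φ : DimDrop p q →⋆ₐ[ℂ] (H →L[ℂ] H)} {x : K → I}
    {K₀ K₁ : Type} [DecidableEq K₀] [DecidableEq K₁] [Fintype K₀] [Fintype K₁]
    (h : HasBlockBasis Φ (A ⊕ K₀ × Fin q) (B ⊕ K₁ × Fin p) x) :
    HasBlockBasis Φ A B (Sum.elim x (Sum.elim (fun _ : K₀ => 0) fun _ : K₁ => 1)) :=
  h.transport _ fun f r c => blockMatrix_regroup x f r c

/-- Up to regrouping, every block basis has less than `q` blocks `c (f 0)` and less than `p` blocks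
`c (f 1)`, and the remaining points are sorted. -/
theorem HasBlockBasis.normalize {Φ : DimDrop p q →⋆ₐ[ℂ] (H →L[ℂ] H)} {x : K → I} {m₀ m₁ : ℕ}
    (h : HasBlockBasis Φ (Fin m₀) (Fin m₁) x) :
    ∃ (a b k : ℕ) (y : Fin k → I), a < q ∧ b < p ∧ Monotone y ∧
      HasBlockBasis Φ (Fin a) (Fin b) y := by
  -- Division with remainder: the quotient counts full groups, which become eigenvalues at the
  -- endpoint, and the remainder is the number of end blocks left over.
  have e₀ : Fin (m₀ % q) ⊕ Fin (m₀ / q) × Fin q ≃ Fin m₀ :=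
    Fintype.equivOfCardEq (by simp [Nat.mod_add_div'])
  have e₁ : Fin (m₁ % p) ⊕ Fin (m₁ / p) × Fin p ≃ Fin m₁ :=
    Fintype.equivOfCardEq (by simp [Nat.mod_add_div'])
  have h' := (h.rename e₀ (.refl _) e₁).regroup
  have e := (Fintype.equivFin (K ⊕ Fin (m₀ / q) ⊕ Fin (m₁ / p))).symm
  have h'' := h'.rename (.refl _) e (.refl _)
  exact ⟨m₀ % q, m₁ % p, _, _, Nat.mod_lt _ (NeZero.pos q), Nat.mod_lt _ (NeZero.pos p),
    Tuple.monotone_sort _, h''.rename (.refl _) (Tuple.sort _) (.refl _)⟩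

end BlockBasis

/-! ### Decomposing a finite-dimensional representation -/

section Decomposition

variable {p q : ℕ} [NeZero p] [NeZero q]
variable {H : Type*} [NormedAddCommGroup H] [InnerProductSpace ℂ H] [CompleteSpace H]

omit [NeZero p] [NeZero q] in
theorem inner_eq_zero_of_mem_centralEigenspace {Φ : DimDrop p q →⋆ₐ[ℂ] (H →L[ℂ] H)} {x y : I}
    (hxy : x ≠ y) {v w : H} (hv : v ∈ centralEigenspace Φ x) (hw : w ∈ centralEigenspace Φ y) :
    inner ℂ v w = 0 := by
  have h1 : inner ℂ (Φ position v) w = inner ℂ v (Φ position w) := by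
    rw [← ContinuousLinearMap.adjoint_inner_right, ← ContinuousLinearMap.star_eq_adjoint,
      ← map_star, star_position]
  rw [mem_centralEigenspace.1 hv, mem_centralEigenspace.1 hw, inner_smul_left, inner_smul_right,
    Complex.conj_ofReal] at h1
  by_contra hne
  have h2 := mul_right_cancel₀ hne h1
  exact hxy (Subtype.ext (by exact_mod_cast h2))

omit [NeZero p] [NeZero q] in
-- For `z` outside the interval, `s ↦ (s - z)⁻¹` is a continuous central function inverting
-- `position - z`, so `position - z` cannot annihilate a nonzero vector.
theorem mem_unitInterval_of_eigenvector {Φ : DimDrop p q →⋆ₐ[ℂ] (H →L[ℂ] H)} {z : ℂ} {v : H}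
    (hv : Φ position v = z • v) (hv0 : v ≠ 0) : ∃ x : I, ((x : ℝ) : ℂ) = z := by
  by_contra! hz
  have hz' : ∀ s : I, ((s : ℝ) : ℂ) - z ≠ 0 := fun s => sub_ne_zero.2 (hz s)
  let g : C(I, ℂ) := ⟨fun s => (((s : ℝ) : ℂ) - z)⁻¹, Continuous.inv₀ (by fun_prop) hz'⟩
  have h1 : (central g : DimDrop p q) * position + (-z) • central g = 1 := by
    refine DimDrop.ext fun s => ?_
    rw [DimDrop.add_apply, DimDrop.mul_apply, DimDrop.smul_apply, central_apply, position_apply,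
      DimDrop.one_apply, smul_mul_smul_comm, mul_one, smul_smul, ← add_smul]
    have : g s * ((s : ℝ) : ℂ) + -z * g s = 1 := by
      change (((s : ℝ) : ℂ) - z)⁻¹ * ((s : ℝ) : ℂ) + -z * (((s : ℝ) : ℂ) - z)⁻¹ = 1
      have := hz' s
      field_simp
      ring
    rw [this, one_smul]
  have h2 : Φ (central g * position + (-z) • central g) v = 0 := by
    rw [map_add, map_mul, map_smul, add_apply, mul_apply_eq_comp, hv, map_smul, smul_apply,
      neg_smul, add_neg_cancel]
  rw [h1, map_one] at h2
  exact hv0 h2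

/-- The self-adjoint operator `Φ position` splits `H` into orthogonal eigenspaces. Each is a
multiple of the evaluation at its eigenvalue, with `leftEndHom` and `rightEndHom` replacing
evaluation at the endpoints, where evaluation is not onto the full matrix algebra in general. -/
theorem exists_hasBlockBasis [FiniteDimensional ℂ H] (Φ : DimDrop p q →⋆ₐ[ℂ] (H →L[ℂ] H)) :
    ∃ (a b k : ℕ) (y : Fin k → I), a < q ∧ b < p ∧ Monotone y ∧
      HasBlockBasis Φ (Fin a) (Fin b) y := by
  classical
  have hT : (Φ position).toLinearMap.IsSymmetric := by
    intro v w
    change inner ℂ (Φ position v) w = inner ℂ v (Φ position w)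
    rw [← ContinuousLinearMap.adjoint_inner_right, ← ContinuousLinearMap.star_eq_adjoint,
      ← map_star, star_position]
  -- Interior eigenvalues only; the endpoints are handled apart, with multiplicities `m₀` and `m₁`
  -- that may be zero.
  let X : Set I := {x | x ≠ 0 ∧ x ≠ 1 ∧
    Module.End.HasEigenvalue (Φ position).toLinearMap ((x : ℝ) : ℂ)}
  have hX : X.Finite := by
    refine Set.Finite.of_finite_image (f := fun x : I => ((x : ℝ) : ℂ)) ?_ ?_
    · refine (Module.End.finite_hasEigenvalue (Φ position).toLinearMap).subset ?_
      rintro _ ⟨x, hx, rfl⟩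
      exact hx.2.2
    · intro x _ y _ h
      exact Subtype.ext (by simpa using h)
  have := hX.fintype
  obtain ⟨m₀, u₀, ho₀, he₀, hs₀, hf₀⟩ := exists_orthonormal_centralEigenspace Φ 0
    (leftEndHom : DimDrop p q →⋆ₐ[ℂ] _) leftEndHom_surjective fun f hf => by
      rw [leftEnd_kronecker_one, show leftEnd f = 0 from hf, Matrix.zero_kronecker]
  obtain ⟨m₁, u₁, ho₁, he₁, hs₁, hf₁⟩ := exists_orthonormal_centralEigenspace Φ 1
    (rightEndHom : DimDrop p q →⋆ₐ[ℂ] _) rightEndHom_surjective fun f hf => by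
      rw [one_kronecker_rightEnd, show rightEnd f = 0 from hf, Matrix.kronecker_zero]
  choose m u ho he hs hf using fun x : X => exists_orthonormal_centralEigenspace Φ x.1
    (evalHom x.1 : DimDrop p q →⋆ₐ[ℂ] _) (evalHom_surjective x.2.1 x.2.2.1) fun f hf => hf
  let U : ((Fin m₀ × Fin p) ⊕ ((Σ x : X, Fin (m x)) × (Fin p × Fin q))) ⊕ (Fin m₁ × Fin q) → H :=
    Sum.elim (Sum.elim u₀ fun c => u c.1.1 (c.1.2, c.2)) u₁
  have hU : Orthonormal ℂ U := by
    rw [orthonormal_iff_ite] at ho₀ ho₁ ⊢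
    rintro ((c | ⟨⟨x, j⟩, i⟩) | c) ((d | ⟨⟨y, j'⟩, i'⟩) | d)
    · simpa [U] using ho₀ c d
    · simpa [U] using inner_eq_zero_of_mem_centralEigenspace y.2.1.symm (he₀ c) (he y _)
    · simpa [U] using inner_eq_zero_of_mem_centralEigenspace zero_ne_one (he₀ c) (he₁ d)
    · simpa [U] using inner_eq_zero_of_mem_centralEigenspace x.2.1 (he x _) (he₀ d)
    · by_cases hxy : x = y
      · subst hxy
        simpa [U, Prod.ext_iff] using orthonormal_iff_ite.1 (ho x) (j, i) (j', i')
      · have h1 := inner_eq_zero_of_mem_centralEigenspace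
          (fun h => hxy (Subtype.ext h)) (he x (j, i)) (he y (j', i'))
        simpa [U, hxy] using h1
    · simpa [U] using inner_eq_zero_of_mem_centralEigenspace x.2.2.1 (he x _) (he₁ d)
    · simpa [U] using inner_eq_zero_of_mem_centralEigenspace one_ne_zero (he₁ c) (he₀ d)
    · simpa [U] using inner_eq_zero_of_mem_centralEigenspace y.2.2.1.symm (he₁ c) (he y _)
    · simpa [U] using ho₁ c d
  have hspan : ⊤ ≤ Submodule.span ℂ (Set.range U) := by
    have h1 := hT.orthogonalComplement_iSup_eigenspaces_eq_bot
    rw [Submodule.orthogonal_eq_bot_iff] at h1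
    rw [← h1, iSup_le_iff]
    intro z v hv
    rw [Module.End.mem_eigenspace_iff] at hv
    by_cases hv0 : v = 0
    · rw [hv0]; exact zero_mem _
    obtain ⟨x, rfl⟩ := mem_unitInterval_of_eigenvector hv hv0
    have hvx : v ∈ centralEigenspace Φ x := hv
    by_cases hx0 : x = 0
    · subst hx0
      refine Submodule.span_mono ?_ (hs₀ hvx)
      rintro _ ⟨c, rfl⟩
      exact ⟨.inl (.inl c), rfl⟩
    by_cases hx1 : x = 1
    · subst hx1
      refine Submodule.span_mono ?_ (hs₁ hvx)
      rintro _ ⟨c, rfl⟩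
      exact ⟨.inr c, rfl⟩
    have hxX : x ∈ X := ⟨hx0, hx1,
      Module.End.hasEigenvalue_of_hasEigenvector ⟨Module.End.mem_eigenspace_iff.2 hv, hv0⟩⟩
    refine Submodule.span_mono ?_ (hs ⟨x, hxX⟩ hvx)
    rintro _ ⟨⟨j, i⟩, rfl⟩
    exact ⟨.inl (.inr (⟨⟨x, hxX⟩, j⟩, i)), rfl⟩
  refine HasBlockBasis.normalize (m₀ := m₀) (m₁ := m₁) (x := fun k : (Σ x : X, Fin (m x)) => k.1.1)
    ⟨OrthonormalBasis.mk hU hspan, fun f c => ?_⟩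
  simp only [OrthonormalBasis.coe_mk]
  rcases c with (⟨j, i⟩ | ⟨⟨x, j⟩, i⟩) | ⟨j, i⟩
  · rw [show U (.inl (.inl (j, i))) = u₀ (j, i) from rfl, hf₀]
    rw [Fintype.sum_sum_type, Fintype.sum_sum_type, Fintype.sum_prod_type]
    simp [blockMatrix, U, Matrix.one_apply, ite_smul, Finset.sum_ite_irrel, leftEndHom]
  · rw [show U (.inl (.inr (⟨x, j⟩, i))) = u x (j, i) from rfl, hf]
    rw [Fintype.sum_sum_type, Fintype.sum_sum_type, Fintype.sum_prod_type (α₁ := Σ x : X, Fin (m x))]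
    simp [blockMatrix, U, ite_smul, Finset.sum_ite_irrel, evalHom_apply]
  · rw [show U (.inr (j, i)) = u₁ (j, i) from rfl, hf₁]
    rw [Fintype.sum_sum_type, Fintype.sum_sum_type, Fintype.sum_prod_type (α₁ := Fin m₁)]
    simp [blockMatrix, U, Matrix.one_apply, ite_smul, Finset.sum_ite_irrel, rightEndHom]

end Decomposition

/-! ### Existence of normalized eigenvalue patterns -/

section PatternExistence

/-- Sorted points depend continuously on a parameter as soon as all their symmetric averages do. -/
theorem continuous_of_continuous_sum {X : Type*} [TopologicalSpace X] {k : ℕ}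
    {y : X → Fin k → I} (hy : ∀ s, Monotone (y s))
    (hc : ∀ g : C(I, ℝ), Continuous fun s => ∑ i, g (y s i)) (i : Fin k) :
    Continuous fun s => y s i := by
  rw [continuous_iff_continuousAt]
  intro s₀
  refine tendsto_order.2 ⟨fun c hlt => ?_, fun c hlt => ?_⟩
  · have hlt' : (c : ℝ) < y s₀ i := hlt
    -- A soft count of the points above `c`. At `s₀` all indices `j ≥ i` count fully; if `y s i ≤
    -- c`, only indices `j > i` can contribute, so the sum would drop by at least one, against
    -- continuity.
    let g : C(I, ℝ) := ⟨fun z => min 1 (max 0 (((z : ℝ) - c) / (y s₀ i - c))), by fun_prop⟩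
    have g0 : ∀ z, 0 ≤ g z := fun z => le_min zero_le_one (le_max_left _ _)
    have g1 : ∀ z, g z ≤ 1 := fun z => min_le_left _ _
    have hlow : ∀ z : I, z ≤ c → g z = 0 := fun z hz => by
      have hz' : (z : ℝ) ≤ c := hz
      have : ((z : ℝ) - c) / (y s₀ i - c) ≤ 0 :=
        div_nonpos_of_nonpos_of_nonneg (by linarith) (by linarith)
      simp [g, max_eq_left this]
    have hhigh : ∀ z : I, y s₀ i ≤ z → g z = 1 := fun z hz => by
      have hz' : (y s₀ i : ℝ) ≤ z := hz
      have : 1 ≤ ((z : ℝ) - c) / (y s₀ i - c) := by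
        rw [one_le_div (by linarith)]; linarith
      simp only [g, ContinuousMap.coe_mk]
      rw [max_eq_right (by linarith), min_eq_left this]
    have hbig : ((Finset.Ioi i).card : ℝ) < ∑ j, g (y s₀ j) := by
      calc ((Finset.Ioi i).card : ℝ) < (Finset.Ici i).card := by
            rw [Fin.card_Ioi, Fin.card_Ici, Nat.cast_lt]
            have := i.2
            omega
        _ = ∑ j ∈ Finset.Ici i, g (y s₀ j) := by
            rw [Finset.sum_congr rfl fun j hj => hhigh _ (hy s₀ (Finset.mem_Ici.1 hj))]
            simp
        _ ≤ ∑ j, g (y s₀ j) :=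
            Finset.sum_le_sum_of_subset_of_nonneg (Finset.subset_univ _) fun _ _ _ => g0 _
    filter_upwards [((hc g).tendsto s₀).eventually_const_lt hbig] with s hs
    by_contra hcon
    rw [not_lt] at hcon
    refine absurd hs (not_lt.2 ?_)
    rw [← Finset.sum_subset (Finset.subset_univ (Finset.Ioi i)) fun j _ hj =>
      hlow _ ((hy s (not_lt.1 fun h => hj (Finset.mem_Ioi.2 h))).trans hcon)]
    exact (Finset.sum_le_sum fun j _ => g1 _).trans (by simp)
  · have hlt' : (y s₀ i : ℝ) < c := hlt
    -- The mirror image: a soft count of the points below `c`.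
    let g : C(I, ℝ) := ⟨fun z => min 1 (max 0 (((c : ℝ) - z) / (c - y s₀ i))), by fun_prop⟩
    have g0 : ∀ z, 0 ≤ g z := fun z => le_min zero_le_one (le_max_left _ _)
    have g1 : ∀ z, g z ≤ 1 := fun z => min_le_left _ _
    have hlow : ∀ z : I, c ≤ z → g z = 0 := fun z hz => by
      have hz' : (c : ℝ) ≤ z := hz
      have : ((c : ℝ) - z) / (c - y s₀ i) ≤ 0 :=
        div_nonpos_of_nonpos_of_nonneg (by linarith) (by linarith)
      simp [g, max_eq_left this]
    have hhigh : ∀ z : I, z ≤ y s₀ i → g z = 1 := fun z hz => by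
      have hz' : (z : ℝ) ≤ y s₀ i := hz
      have : 1 ≤ ((c : ℝ) - z) / (c - y s₀ i) := by
        rw [one_le_div (by linarith)]; linarith
      simp only [g, ContinuousMap.coe_mk]
      rw [max_eq_right (by linarith), min_eq_left this]
    have hbig : ((Finset.Iio i).card : ℝ) < ∑ j, g (y s₀ j) := by
      calc ((Finset.Iio i).card : ℝ) < (Finset.Iic i).card := by
            rw [Fin.card_Iio, Fin.card_Iic, Nat.cast_lt]
            have := i.2
            omega
        _ = ∑ j ∈ Finset.Iic i, g (y s₀ j) := by
            rw [Finset.sum_congr rfl fun j hj => hhigh _ (hy s₀ (Finset.mem_Iic.1 hj))]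
            simp
        _ ≤ ∑ j, g (y s₀ j) :=
            Finset.sum_le_sum_of_subset_of_nonneg (Finset.subset_univ _) fun _ _ _ => g0 _
    filter_upwards [((hc g).tendsto s₀).eventually_const_lt hbig] with s hs
    by_contra hcon
    rw [not_lt] at hcon
    refine absurd hs (not_lt.2 ?_)
    rw [← Finset.sum_subset (Finset.subset_univ (Finset.Iio i)) fun j _ hj =>
      hlow _ (hcon.trans (hy s (not_lt.1 fun h => hj (Finset.mem_Iio.2 h))))]
    exact (Finset.sum_le_sum fun j _ => g1 _).trans (by simp)

variable {p q : ℕ} [NeZero p] [NeZero q]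

omit [NeZero p] in
theorem leftEnd_central (g : C(I, ℂ)) : leftEnd (central g : DimDrop p q) = g 0 • 1 :=
  leftEnd_eq (by rw [central_apply, Matrix.smul_kronecker, Matrix.one_kronecker_one])

omit [NeZero q] in
theorem rightEnd_central (g : C(I, ℂ)) : rightEnd (central g : DimDrop p q) = g 1 • 1 :=
  rightEnd_eq (by rw [central_apply, Matrix.kronecker_smul, Matrix.one_kronecker_one])

theorem trace_blockMatrix_central {A K B : Type} [DecidableEq A] [DecidableEq K] [DecidableEq B]
    [Fintype A] [Fintype K] [Fintype B] (x : K → I) (g : C(I, ℂ)) :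
    (blockMatrix A B x (central g : DimDrop p q)).trace =
      (Fintype.card A * p) * g 0 + (p * q) * ∑ k, g (x k) + (Fintype.card B * q) * g 1 := by
  simp only [Matrix.trace, Fintype.sum_sum_type, Fintype.sum_prod_type, Matrix.diag_apply]
  simp [blockMatrix, leftEnd_central, rightEnd_central, central_apply, Finset.mul_sum]
  ring_nf

/-- The remainders and the number of blocks are determined by the dimension. -/
theorem block_numbers_unique (hpq : p.Coprime q) {a b k a' b' k' : ℕ} (ha : a < q) (hb : b < p)
    (ha' : a' < q) (hb' : b' < p)
    (h : a * p + k * (p * q) + b * q = a' * p + k' * (p * q) + b' * q) :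
    a = a' ∧ b = b' ∧ k = k' := by
  have hp := NeZero.pos p
  have hq := NeZero.pos q
  -- Modulo `q` only the first summand survives, and coprimality allows cancelling `p`; modulo `p`
  -- the roles are exchanged.
  have h1 : a * p ≡ a' * p [MOD q] := by
    have : (a * p + k * (p * q) + b * q) % q = (a' * p + k' * (p * q) + b' * q) % q := by rw [h]
    simpa [Nat.ModEq, ← mul_assoc] using this
  have h2 : b * q ≡ b' * q [MOD p] := by
    have : (b * q + k * q * p + a * p) % p = (b' * q + k' * q * p + a' * p) % p := by
      congr 1; linarith
    simpa [Nat.ModEq] using this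
  have ea : a = a' :=
    (Nat.ModEq.cancel_right_of_coprime hpq.symm h1).eq_of_lt_of_lt ha ha'
  have eb : b = b' :=
    (Nat.ModEq.cancel_right_of_coprime hpq h2).eq_of_lt_of_lt hb hb'
  subst ea eb
  refine ⟨rfl, rfl, Nat.eq_of_mul_eq_mul_right (Nat.mul_pos hp hq) ?_⟩
  linarith

/-- Matrices as operators on the Euclidean space. -/
def euclideanHom (n : Type) [Fintype n] [DecidableEq n] :
    Matrix n n ℂ →⋆ₐ[ℂ] (EuclideanSpace ℂ n →L[ℂ] EuclideanSpace ℂ n) :=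
  (Matrix.toEuclideanCLM (n := n) (𝕜 := ℂ)).toStarAlgHom

/-- A block basis of `ℂⁿ` gives a unitary matrix. -/
theorem HasBlockBasis.exists_unitary {n : Type} [Fintype n] [DecidableEq n]
    {A K B : Type} [DecidableEq A] [DecidableEq K] [DecidableEq B]
    [Fintype A] [Fintype K] [Fintype B] {φ : DimDrop p q →⋆ₐ[ℂ] Matrix n n ℂ} {x : K → I}
    (h : HasBlockBasis
      ((euclideanHom n).comp φ) A B x)
    (e : ((A × Fin p) ⊕ (K × (Fin p × Fin q))) ⊕ (B × Fin q) ≃ n) :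
    ∃ v : Matrix.unitaryGroup n ℂ, ∀ f, φ f = (v : Matrix n n ℂ) *
      Matrix.reindex e e (blockMatrix A B x f) * star (v : Matrix n n ℂ) := by
  obtain ⟨u, hu⟩ := h
  let u' := u.reindex e
  -- The columns of `V` are the vectors of the block basis, so the block form of the representation
  -- reads `φ f * V = V * blocks`.
  let V : Matrix n n ℂ := (EuclideanSpace.basisFun n ℂ).toBasis.toMatrix u'
  have hV : V ∈ Matrix.unitaryGroup n ℂ :=
    OrthonormalBasis.toMatrix_orthonormalBasis_mem_unitary _ _
  refine ⟨⟨V, hV⟩, fun f => ?_⟩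
  have h1 : φ f * V = V * Matrix.reindex e e (blockMatrix A B x f) := by
    ext r c
    have h2 := congrArg (fun w : EuclideanSpace ℂ n => w r) (hu f (e.symm c))
    have h3 : ∀ r c, V r c = u (e.symm c) r := fun r c => by
      simp [V, u', Module.Basis.toMatrix_apply]
    simp only [Matrix.mul_apply, h3, Matrix.reindex_apply, Matrix.submatrix_apply]
    rw [← Equiv.sum_comp e fun j => u (e.symm j) r * blockMatrix A B x f (e.symm j) (e.symm c)]
    simp only [Equiv.symm_apply_apply]
    simp only [PiLp.smul_apply, WithLp.ofLp_sum, Finset.sum_apply, smul_eq_mul] at h2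
    rw [Finset.sum_congr rfl fun j _ => mul_comm _ _]
    refine Eq.trans ?_ (h2.trans ?_)
    · rw [Finset.sum_congr rfl fun j _ => mul_comm _ _]
      rfl
    · simp [mul_comm]
  change φ f = V * _ * star V
  rw [← h1, mul_assoc, (Matrix.mem_unitaryGroup_iff).1 hV, mul_one]

variable {p' q' : ℕ}

/-- Each evaluation of `ι` is decomposed separately. Coprimality forces the same block numbers at
every `s`, so a single index set serves throughout. The sorted points are continuous because traces
of images of central functions are. -/
theorem exists_isNormalizedPattern (hpq : p.Coprime q) (ι : DimDrop p q →⋆ₐ[ℂ] DimDrop p' q') :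
    ∃ (k : ℕ) (t : Fin k → C(I, I)), IsNormalizedPattern ι t := by
  choose a b k y ha hb hy hB using fun s : I => exists_hasBlockBasis
    ((euclideanHom (Fin p' × Fin q')).comp
      ((evalHom s).comp ι))
  have hdim : ∀ s, a s * p + k s * (p * q) + b s * q = p' * q' := by
    intro s
    obtain ⟨u, -⟩ := hB s
    have h1 := Module.finrank_eq_card_basis u.toBasis
    rw [finrank_euclideanSpace] at h1
    simpa using h1.symm
  have hu := fun s => block_numbers_unique hpq (ha s) (hb s) (ha 0) (hb 0)
    ((hdim s).trans (hdim 0).symm)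
  have hB' : ∀ s, ∃ y : Fin (k 0) → I, Monotone y ∧ HasBlockBasis
      ((euclideanHom (Fin p' × Fin q')).comp
        ((evalHom s).comp ι)) (Fin (a 0)) (Fin (b 0)) y := by
    intro s
    rw [← (hu s).1, ← (hu s).2.1, ← (hu s).2.2]
    exact ⟨y s, hy s, hB s⟩
  choose z hz hzB using hB'
  have e : BlockIndex p q (a 0) (k 0) (b 0) ≃ Fin p' × Fin q' :=
    Fintype.equivOfCardEq (by simpa using hdim 0)
  choose v hv using fun s => (hzB s).exists_unitary e
  have hcont : ∀ i, Continuous fun s => z s i := by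
    refine continuous_of_continuous_sum hz fun g => ?_
    let gc : C(I, ℂ) := ⟨fun s => (g s : ℂ), by fun_prop⟩
    have h1 : ∀ s, ((ι (central gc)).1 s).trace =
        ((a 0 : ℂ) * p) * gc 0 + (p * q) * ∑ i, gc (z s i) + (b 0 * q) * gc 1 := by
      intro s
      have h2 := hv s (central gc)
      change (ι (central gc)).1 s = _ at h2
      rw [h2, Matrix.trace_mul_cycle,
        (Matrix.mem_unitaryGroup_iff').1 (v s).2, one_mul]
      have h3 := trace_blockMatrix_central (p := p) (q := q) (A := Fin (a 0)) (B := Fin (b 0))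
        (z s) gc
      rw [Fintype.card_fin, Fintype.card_fin] at h3
      rw [← h3]
      exact Equiv.sum_comp e.symm fun i => blockMatrix _ _ (z s) (central gc) i i
    have hpq0 : ((p : ℂ) * q) ≠ 0 := by simp [NeZero.ne]
    -- The end blocks contribute constants to the trace, so the symmetric sum is an affine function
    -- of a continuous trace.
    have h4 : ∀ s, ∑ i, g (z s i) = ((((ι (central gc)).1 s).trace -
        ((a 0 : ℂ) * p) * gc 0 - (b 0 * q) * gc 1) / (p * q)).re := by
      intro s
      rw [h1, show ∑ i, gc (z s i) = ((∑ i, g (z s i) : ℝ) : ℂ) by push_cast; rfl,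
        add_sub_right_comm, add_sub_cancel_left, add_sub_cancel_right, mul_div_cancel_left₀ _ hpq0,
        Complex.ofReal_re]
    simp only [h4]
    have h5 : Continuous fun s => ((ι (central gc)).1 s).trace :=
      Continuous.matrix_trace (ι (central gc)).1.continuous
    fun_prop
  refine ⟨k 0, fun i => ⟨fun s => z s i, hcont i⟩, ⟨a 0, b 0, ha 0, hb 0, e, v, fun f s => ?_⟩,
    fun i j hij s => hz s hij⟩
  exact hv s f

end PatternExistence

/-! ### Norm and trace estimates from a pattern -/

section PatternConsequences

variable {p q : ℕ} [NeZero p] [NeZero q] {n : Type} [Fintype n] [DecidableEq n]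

/-- The block diagonal embedding of a finite product of matrix algebras. -/
def diagonalHom {a b k : ℕ} (e : BlockIndex p q a k b ≃ n) :
    (Fin k → Matrix (Fin p × Fin q) (Fin p × Fin q) ℂ) →⋆ₙₐ[ℂ] Matrix n n ℂ where
  toFun g := Matrix.reindex e e (Matrix.fromBlocks (Matrix.fromBlocks 0 0 0
    (Matrix.of fun x y => if x.1 = y.1 then g x.1 x.2 y.2 else 0)) 0 0 0)
  map_smul' r g := by
    ext i j
    rcases h : e.symm i with (_ | _) | _ <;> rcases h' : e.symm j with (_ | _) | _ <;> simp [h, h']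
  map_zero' := by
    ext i j
    rcases h : e.symm i with (_ | _) | _ <;> rcases h' : e.symm j with (_ | _) | _ <;> simp [h, h']
  map_add' g g' := by
    ext i j
    rcases h : e.symm i with (_ | _) | _ <;> rcases h' : e.symm j with (_ | _) | _ <;>
      simp [h, h', ite_add_ite]
  map_mul' g g' := by
    have h : (Matrix.of fun x y : Fin k × (Fin p × Fin q) =>
          if x.1 = y.1 then (g * g') x.1 x.2 y.2 else 0) =
        (Matrix.of fun x y => if x.1 = y.1 then g x.1 x.2 y.2 else 0) *
        (Matrix.of fun x y : Fin k × (Fin p × Fin q) =>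
          if x.1 = y.1 then g' x.1 x.2 y.2 else 0) := by
      ext ⟨x, i⟩ ⟨y, j⟩
      rw [Matrix.mul_apply, Fintype.sum_prod_type]
      by_cases hxy : x = y
      · subst hxy
        simp [Matrix.mul_apply, Finset.sum_ite_irrel]
      · simp [hxy, Finset.sum_ite_irrel]
    rw [h]
    simp [Matrix.submatrix_mul_equiv, Matrix.fromBlocks_multiply]
  map_star' g := by
    have h : (Matrix.of fun x y : Fin k × (Fin p × Fin q) =>
          if x.1 = y.1 then (star g) x.1 x.2 y.2 else 0) =
        Matrix.conjTranspose (Matrix.of fun x y : Fin k × (Fin p × Fin q) =>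
          if x.1 = y.1 then g x.1 x.2 y.2 else 0) := by
      ext ⟨x, i⟩ ⟨y, j⟩
      by_cases hxy : x = y
      · subst hxy; simp [Matrix.star_apply]
      · simp [hxy, Ne.symm hxy]
    rw [h]
    simp [Matrix.star_eq_conjTranspose, Matrix.fromBlocks_conjTranspose,
      Matrix.conjTranspose_submatrix]

/-- The end blocks do not depend on `s` and cancel. The remaining difference is the image of a tuple
of matrices under a `*`-homomorphism, which is contractive for the supremum norm of the tuple. -/
theorem norm_reindex_patternMatrix_sub_le {a b k : ℕ} (e : BlockIndex p q a k b ≃ n)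
    (t : Fin k → C(I, I)) (f : DimDrop p q) (s s' : I) {r : ℝ} (hr : 0 ≤ r)
    (h : ∀ i, ‖f.1 (t i s) - f.1 (t i s')‖ ≤ r) :
    ‖Matrix.reindex e e (patternMatrix a b t f s) -
      Matrix.reindex e e (patternMatrix a b t f s')‖ ≤ r := by
  have h1 : Matrix.reindex e e (patternMatrix a b t f s) -
      Matrix.reindex e e (patternMatrix a b t f s') =
      diagonalHom e fun i => f.1 (t i s) - f.1 (t i s') := by
    ext i j
    change patternMatrix a b t f s (e.symm i) (e.symm j) -
      patternMatrix a b t f s' (e.symm i) (e.symm j) =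
      (Matrix.fromBlocks (Matrix.fromBlocks 0 0 0 (Matrix.of _)) 0 0 0) (e.symm i) (e.symm j)
    rcases e.symm i with (_ | _) | _ <;> rcases e.symm j with (_ | _) | _ <;>
      simp [patternMatrix]
    split_ifs <;> simp
  rw [h1]
  exact (NonUnitalStarAlgHom.norm_apply_le (diagonalHom e) _).trans
    ((pi_norm_le_iff_of_nonneg hr).2 h)

variable {p' q' : ℕ} {ι : DimDrop p q →⋆ₐ[ℂ] DimDrop p' q'} {a b k : ℕ} {t : Fin k → C(I, I)}

theorem IsEigenvaluePattern.trace_eq (h : IsEigenvaluePattern ι a b t) (f : DimDrop p q) (s : I) :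
    ((ι f).1 s).trace = (patternMatrix a b t f s).trace := by
  obtain ⟨-, -, e, v, hv⟩ := h
  rw [hv, Matrix.trace_mul_cycle, (Matrix.mem_unitaryGroup_iff').1 (v s).2, one_mul]
  exact Equiv.sum_comp e.symm fun i => patternMatrix a b t f s i i

theorem IsEigenvaluePattern.trace_central (h : IsEigenvaluePattern ι a b t) (g : C(I, ℂ)) (s : I) :
    ((ι (central g)).1 s).trace =
      (a * p) * g 0 + (p * q) * ∑ i, g (t i s) + (b * q) * g 1 := by
  rw [h.trace_eq, ← blockMatrix_eq_patternMatrix, trace_blockMatrix_central, Fintype.card_fin,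
    Fintype.card_fin]

/-- The values of `ι f` are unitarily equivalent up to the oscillation of `f` along the
eigenvalue functions. -/
theorem IsEigenvaluePattern.exists_unitary_norm_sub_le (h : IsEigenvaluePattern ι a b t)
    (f : DimDrop p q) (s s' : I) {r : ℝ} (hr : 0 ≤ r)
    (hf : ∀ i, ‖f.1 (t i s) - f.1 (t i s')‖ ≤ r) :
    ∃ u ∈ Matrix.unitaryGroup (Fin p' × Fin q') ℂ,
      ‖(ι f).1 s - u * (ι f).1 s' * star u‖ ≤ r := by
  obtain ⟨e, v, hvu, hv⟩ : ∃ (e : BlockIndex p q a k b ≃ Fin p' × Fin q')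
      (v : I → Matrix (Fin p' × Fin q') (Fin p' × Fin q') ℂ),
      (∀ s, v s ∈ Matrix.unitaryGroup (Fin p' × Fin q') ℂ) ∧ ∀ f s, (ι f).1 s =
        v s * Matrix.reindex e e (patternMatrix a b t f s) * star (v s) := by
    obtain ⟨-, -, e, v, hv⟩ := h
    exact ⟨e, fun s => v s, fun s => (v s).2, hv⟩
  have h1 := (Matrix.mem_unitaryGroup_iff').1 (hvu s')
  -- This unitary undoes the conjugation at `s'` and applies the one at `s`, leaving only the
  -- difference of the block matrices.
  refine ⟨v s * star (v s'), mul_mem (hvu s) (Unitary.star_mem (hvu s')), ?_⟩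
  have h2 : (ι f).1 s - v s * star (v s') * (ι f).1 s' * star (v s * star (v s')) =
      v s * (Matrix.reindex e e (patternMatrix a b t f s) -
        Matrix.reindex e e (patternMatrix a b t f s')) * star (v s) := by
    rw [hv f s, hv f s', star_mul, star_star, mul_sub, sub_mul]
    congr 1
    calc _ = v s * (star (v s') * v s') * Matrix.reindex e e (patternMatrix a b t f s') *
          (star (v s') * v s') * star (v s) := by simp only [mul_assoc]
      _ = _ := by rw [h1, mul_one, mul_one]
  rw [h2, CStarRing.norm_mul_mem_unitary _ (Unitary.star_mem (hvu s)),
    CStarRing.norm_mem_unitary_mul _ (hvu s)]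
  exact norm_reindex_patternMatrix_sub_le e t f s s' hr hf

theorem norm_entry_le {m : Type*} [Fintype m] [DecidableEq m] (M : Matrix m m ℂ) (i j : m) :
    ‖M i j‖ ≤ ‖M‖ := by
  have h1 := M.l2_opNorm_mulVec (EuclideanSpace.single j 1)
  rw [PiLp.norm_single, norm_one, mul_one] at h1
  refine le_trans ?_ ((PiLp.norm_apply_le _ i).trans h1)
  simp

theorem norm_trace_le {m : Type*} [Fintype m] [DecidableEq m] (M : Matrix m m ℂ) :
    ‖M.trace‖ ≤ Fintype.card m * ‖M‖ := by
  refine (norm_sum_le _ _).trans ((Finset.sum_le_sum fun i _ => norm_entry_le M i i).trans ?_)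
  simp

/-- On central elements the block matrix is diagonal, with `g (t i s)` among its entries;
conjugation by a unitary preserves the norm. -/
theorem IsEigenvaluePattern.norm_apply_le_norm (h : IsEigenvaluePattern ι a b t) (g : C(I, ℂ))
    (i : Fin k) (s : I) : ‖g (t i s)‖ ≤ ‖ι (central g)‖ := by
  obtain ⟨-, -, e, v, hv⟩ := h
  let c : BlockIndex p q a k b := .inl (.inr (i, (0, 0)))
  have h1 : Matrix.reindex e e (patternMatrix a b t (central g) s) (e c) (e c) = g (t i s) := by
    simp [c, patternMatrix, central_apply]
  have h2 : ‖(ι (central g)).1 s‖ =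
      ‖Matrix.reindex e e (patternMatrix a b t (central g) s)‖ := by
    rw [hv, CStarRing.norm_mul_mem_unitary _ (Unitary.star_mem (v s).2),
      CStarRing.norm_mem_unitary_mul _ (v s).2]
  rw [← h1]
  exact ((norm_entry_le _ _ _).trans h2.ge).trans (DimDrop.norm_apply_le _ s)

end PatternConsequences

/-! ### Tracial functionals on a dimension drop algebra -/

section Traces

/-- A linear functional on a matrix algebra with the trace property is a multiple of the trace. -/
theorem eq_trace_of_mul_comm {n : Type*} [Fintype n] [DecidableEq n] [Nonempty n]
    (L : Matrix n n ℂ →ₗ[ℂ] ℂ) (hL : ∀ A B, L (A * B) = L (B * A)) (A : Matrix n n ℂ) :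
    L A = A.trace / Fintype.card n * L 1 := by
  obtain ⟨o⟩ := ‹Nonempty n›
  obtain ⟨c, hc⟩ : ∃ c, L (Matrix.single o o 1) = c := ⟨_, rfl⟩
  have h1 : ∀ i j, L (Matrix.single i j 1) = if i = j then c else 0 := by
    intro i j
    have h2 : Matrix.single i j (1 : ℂ) = Matrix.single i o 1 * Matrix.single o j 1 := by simp
    rw [h2, hL]
    by_cases hij : i = j
    · subst hij; simp [hc]
    · simp [hij, Matrix.single_mul_single_of_ne _ _ _ _ (Ne.symm hij)]
  have h3 : ∀ A, L A = A.trace * c := by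
    intro A
    conv_lhs => rw [Matrix.matrix_eq_sum_single A]
    have h4 : ∀ i j, L (Matrix.single i j (A i j)) = A i j * L (Matrix.single i j 1) := by
      intro i j
      rw [← smul_eq_mul, ← map_smul, Matrix.smul_single, smul_eq_mul, mul_one]
    simp only [map_sum, h4, h1, Matrix.trace, Finset.sum_mul, mul_ite, mul_zero,
      Finset.sum_ite_eq, Finset.mem_univ, if_true, Matrix.diag_apply]
  have h5 : (Fintype.card n : ℂ) ≠ 0 := by
    have : Nonempty n := ⟨o⟩
    exact_mod_cast Fintype.card_ne_zero
  rw [h3 A, h3 1, Matrix.trace_one]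
  field_simp

variable {p q : ℕ}

/-- The normalized trace of the values. -/
def normTrace (f : DimDrop p q) : C(I, ℂ) where
  toFun s := (f.1 s).trace / (p * q)
  continuous_toFun := (Continuous.matrix_trace f.1.continuous).div_const _

theorem normTrace_apply (f : DimDrop p q) (s : I) :
    normTrace f s = (f.1 s).trace / (p * q) := rfl

/-- The normalized trace of the values, as a central element. -/
def centralTrace (f : DimDrop p q) : DimDrop p q := central (normTrace f)

theorem centralTrace_apply (f : DimDrop p q) (s : I) :
    (centralTrace f).1 s = normTrace f s • 1 := rfl

theorem centralTrace_add (f g : DimDrop p q) :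
    centralTrace (f + g) = centralTrace f + centralTrace g := by
  refine DimDrop.ext fun s => ?_
  rw [DimDrop.add_apply, centralTrace_apply, centralTrace_apply, centralTrace_apply, ← add_smul]
  simp only [normTrace_apply, DimDrop.add_apply, Matrix.trace_add, add_div]

variable [NeZero p] [NeZero q]

theorem norm_normTrace_le (f : DimDrop p q) (s : I) : ‖normTrace f s‖ ≤ ‖f.1 s‖ := by
  have h := norm_trace_le (f.1 s)
  rw [Fintype.card_prod, Fintype.card_fin, Fintype.card_fin] at h
  have hp : (0 : ℝ) < p * q := by
    exact_mod_cast Nat.mul_pos (NeZero.pos p) (NeZero.pos q)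
  rw [normTrace_apply, norm_div, norm_mul, Complex.norm_natCast, Complex.norm_natCast,
    div_le_iff₀ hp, mul_comm]
  exact_mod_cast h

theorem norm_centralTrace_le (f : DimDrop p q) : ‖centralTrace f‖ ≤ ‖f‖ := by
  refine DimDrop.norm_le (norm_nonneg f) fun s => ?_
  rw [centralTrace_apply, norm_smul, norm_one, mul_one]
  exact (norm_normTrace_le f s).trans (DimDrop.norm_apply_le f s)

section Functional

variable (L : DimDrop p q →ₗ[ℂ] ℂ) (hL : ∀ f g, L (f * g) = L (g * f))
include hL

/-- For a fixed scalar function the functional of `A` is tracial on the matrix algebra: `χ * χ * u`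
splits into `χ * u` and `χ`, both vanishing at the endpoints, so a product `A * B` lifts to a
product of two elements of the algebra. -/
theorem tracial_innerElt (χ u : C(I, ℂ)) (h0 : χ 0 = 0) (h1 : χ 1 = 0)
    (A : Matrix (Fin p × Fin q) (Fin p × Fin q) ℂ) :
    L (innerElt (χ * χ * u) (by simp [h0]) (by simp [h1]) A) =
      A.trace / (p * q) * L (innerElt (χ * χ * u) (by simp [h0]) (by simp [h1]) 1) := by
  let L' : Matrix (Fin p × Fin q) (Fin p × Fin q) ℂ →ₗ[ℂ] ℂ :=
    { toFun := fun A => L (innerElt (χ * χ * u) (by simp [h0]) (by simp [h1]) A)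
      map_add' := fun A B => by
        rw [← map_add]; congr 1
        exact DimDrop.ext fun s => smul_add _ _ _
      map_smul' := fun r A => by
        rw [RingHom.id_apply, ← map_smul]; congr 1
        exact DimDrop.ext fun s => smul_comm _ _ _ }
  have h := eq_trace_of_mul_comm L' (fun A B => ?_) A
  · rw [Fintype.card_prod, Fintype.card_fin, Fintype.card_fin, Nat.cast_mul] at h
    exact h
  · have hAB : ∀ A B : Matrix (Fin p × Fin q) (Fin p × Fin q) ℂ,
        innerElt (χ * χ * u) (by simp [h0]) (by simp [h1]) (A * B) =
          innerElt (χ * u) (by simp [h0]) (by simp [h1]) A * innerElt χ h0 h1 B := by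
      intro A B
      refine DimDrop.ext fun s => ?_
      rw [DimDrop.mul_apply, innerElt_apply, innerElt_apply, innerElt_apply, smul_mul_smul_comm]
      congr 1
      simp only [ContinuousMap.mul_apply]
      ring
    have hBA : ∀ A B : Matrix (Fin p × Fin q) (Fin p × Fin q) ℂ,
        innerElt (χ * χ * u) (by simp [h0]) (by simp [h1]) (A * B) =
          innerElt χ h0 h1 A * innerElt (χ * u) (by simp [h0]) (by simp [h1]) B := by
      intro A B
      refine DimDrop.ext fun s => ?_
      rw [DimDrop.mul_apply, innerElt_apply, innerElt_apply, innerElt_apply, smul_mul_smul_comm]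
      congr 1
      simp only [ContinuousMap.mul_apply]
      ring
    change L _ = L _
    rw [hAB, hBA, hL]

omit [NeZero q] in
theorem tracial_leftElt (g : C(I, ℂ)) (h1 : g 1 = 0) (a : Matrix (Fin p) (Fin p) ℂ) :
    L (leftElt (g * g) (by simp [h1]) a) =
      a.trace / p * L (leftElt (g * g) (by simp [h1]) 1) := by
  let L' : Matrix (Fin p) (Fin p) ℂ →ₗ[ℂ] ℂ :=
    { toFun := fun a => L (leftElt (g * g) (by simp [h1]) a)
      map_add' := fun A B => by
        rw [← map_add]; congr 1
        exact DimDrop.ext fun s => by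
          simp only [DimDrop.add_apply, leftElt_apply, Matrix.add_kronecker, smul_add]
      map_smul' := fun r A => by
        rw [RingHom.id_apply, ← map_smul]; congr 1
        exact DimDrop.ext fun s => by
          simp only [DimDrop.smul_apply, leftElt_apply, Matrix.smul_kronecker, smul_comm r] }
  have h := eq_trace_of_mul_comm L' (fun A B => ?_) a
  · rw [Fintype.card_fin] at h
    exact h
  · have hAB : ∀ A B : Matrix (Fin p) (Fin p) ℂ,
        leftElt (q := q) (g * g) (by simp [h1]) (A * B) = leftElt g h1 A * leftElt g h1 B := by
      intro A B
      refine DimDrop.ext fun s => ?_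
      rw [DimDrop.mul_apply, leftElt_apply, leftElt_apply, leftElt_apply, smul_mul_smul_comm,
        ← Matrix.mul_kronecker_mul, mul_one, ContinuousMap.mul_apply]
    change L _ = L _
    rw [hAB, hAB, hL]

omit [NeZero p] in
theorem tracial_rightElt (g : C(I, ℂ)) (h0 : g 0 = 0) (b : Matrix (Fin q) (Fin q) ℂ) :
    L (rightElt (g * g) (by simp [h0]) b) =
      b.trace / q * L (rightElt (g * g) (by simp [h0]) 1) := by
  let L' : Matrix (Fin q) (Fin q) ℂ →ₗ[ℂ] ℂ :=
    { toFun := fun a => L (rightElt (g * g) (by simp [h0]) a)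
      map_add' := fun A B => by
        rw [← map_add]; congr 1
        exact DimDrop.ext fun s => by
          simp only [DimDrop.add_apply, rightElt_apply, Matrix.kronecker_add, smul_add]
      map_smul' := fun r A => by
        rw [RingHom.id_apply, ← map_smul]; congr 1
        exact DimDrop.ext fun s => by
          simp only [DimDrop.smul_apply, rightElt_apply, Matrix.kronecker_smul, smul_comm r] }
  have h := eq_trace_of_mul_comm L' (fun A B => ?_) b
  · rw [Fintype.card_fin] at h
    exact h
  · have hAB : ∀ A B : Matrix (Fin q) (Fin q) ℂ,
        rightElt (p := p) (g * g) (by simp [h0]) (A * B) = rightElt g h0 A * rightElt g h0 B := by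
      intro A B
      refine DimDrop.ext fun s => ?_
      rw [DimDrop.mul_apply, rightElt_apply, rightElt_apply, rightElt_apply, smul_mul_smul_comm,
        ← Matrix.mul_kronecker_mul, mul_one, ContinuousMap.mul_apply]
    change L _ = L _
    rw [hAB, hAB, hL]

/-- Expanding in matrix units gives elements whose scalar functions are divisible by `χ * χ`. The
off-diagonal ones are killed, and each diagonal one is replaced by its normalized trace. -/
theorem tracial_central_mul (χ : C(I, ℂ)) (h0 : χ 0 = 0) (h1 : χ 1 = 0) (f : DimDrop p q) :
    L (central (χ * χ) * f) = L (centralTrace (central (χ * χ) * f)) := by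
  let ent : Fin p × Fin q → Fin p × Fin q → C(I, ℂ) := fun i j =>
    ⟨fun s => f.1 s i j, f.1.continuous.matrix_elem i j⟩
  have e1 : central (χ * χ) * f = ∑ i, ∑ j,
      innerElt (χ * χ * ent i j) (by simp [h0]) (by simp [h1]) (Matrix.single i j 1) := by
    refine DimDrop.ext fun s => ?_
    rw [DimDrop.mul_apply, central_apply, ← evalHom_apply s (∑ i, _), map_sum]
    simp only [map_sum, evalHom_apply, innerElt_apply, ContinuousMap.mul_apply, mul_smul,
      smul_mul_assoc, one_mul, ← Finset.smul_sum]
    congr 2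
    conv_lhs => rw [Matrix.matrix_eq_sum_single (f.1 s)]
    simp [ent, Matrix.smul_single]
  have e2 : centralTrace (central (χ * χ) * f) = ∑ i, ((p : ℂ) * q)⁻¹ •
      innerElt (χ * χ * ent i i) (by simp [h0]) (by simp [h1]) 1 := by
    refine DimDrop.ext fun s => ?_
    rw [centralTrace_apply, normTrace_apply, DimDrop.mul_apply, central_apply,
      ← evalHom_apply s (∑ i, _), map_sum]
    simp only [map_smul, evalHom_apply, innerElt_apply, smul_smul, ← Finset.sum_smul]
    congr 1
    rw [smul_mul_assoc, one_mul, Matrix.trace_smul, smul_eq_mul, div_eq_mul_inv, mul_comm]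
    simp only [ContinuousMap.mul_apply, Matrix.trace, ent, ContinuousMap.coe_mk,
      ← Finset.mul_sum, Matrix.diag_apply]
  rw [e2, e1, map_sum, map_sum]
  refine Finset.sum_congr rfl fun i _ => ?_
  rw [map_sum, Finset.sum_eq_single i]
  · rw [tracial_innerElt L hL χ (ent i i) h0 h1, map_smul, Matrix.trace_single_eq_same, one_div, smul_eq_mul]
  · intro j _ hj
    rw [tracial_innerElt L hL χ (ent i j) h0 h1, Matrix.trace_single_eq_of_ne _ _ _ hj.symm, zero_div, zero_mul]
  · simp

/-- Subtracting explicit end corrections reduces to elements vanishing at both endpoints. These are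
norm limits of elements `central (χ * χ) * f`, where the claim is known, and boundedness of `L`
passes it to the limit. -/
theorem tracial_eq_centralTrace {C : ℝ} (hC : ∀ f, ‖L f‖ ≤ C * ‖f‖) (f : DimDrop p q) :
    L f = L (centralTrace f) := by
  have key : ∀ f : DimDrop p q, f.1 0 = 0 → f.1 1 = 0 → L f = L (centralTrace f) := by
    intro f hf0 hf1
    have hC0 : 0 ≤ C := by
      have := (norm_nonneg _).trans (hC 1)
      rwa [show ‖(1 : DimDrop p q)‖ = 1 from
        (CStarRing.norm_one (E := C(I, Matrix (Fin p × Fin q) (Fin p × Fin q) ℂ))), mul_one] at this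
    refine eq_of_forall_dist_le fun ε hε => ?_
    obtain ⟨δ, hδ, hδε⟩ : ∃ δ > 0, C * δ + C * δ ≤ ε :=
      ⟨ε / (2 * (C + 1)), by positivity, by
        rw [← mul_add, ← two_mul, mul_div_assoc', mul_div_assoc', div_le_iff₀ (by positivity)]
        nlinarith⟩
    -- This cut-off is 1 where `f` has norm at least `δ` and vanishes where `f` does, so the error
    -- `(1 - χ²) f` has norm at most `δ`.
    let χ : C(I, ℂ) := ⟨fun s => ((min 1 (‖f.1 s‖ / δ) : ℝ) : ℂ), by fun_prop⟩
    have hχ0 : χ 0 = 0 := by simp [χ, hf0]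
    have hχ1 : χ 1 = 0 := by simp [χ, hf1]
    obtain ⟨g, hfg, hgs⟩ : ∃ g : DimDrop p q, f = central (χ * χ) * f + g ∧
        ∀ s, g.1 s = f.1 s - (central (χ * χ) * f).1 s :=
      ⟨f - central (χ * χ) * f, DimDrop.ext fun s => by
        rw [DimDrop.add_apply, DimDrop.sub_apply, add_sub_cancel], fun s => rfl⟩
    have hg : ‖g‖ ≤ δ := by
      refine DimDrop.norm_le hδ.le fun s => ?_
      have h1 : g.1 s = ((1 - (min 1 (‖f.1 s‖ / δ)) ^ 2 : ℝ) : ℂ) • f.1 s := by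
        rw [hgs, DimDrop.mul_apply, central_apply, smul_mul_assoc, one_mul]
        nth_rw 1 [← one_smul ℂ (f.1 s)]
        rw [← sub_smul]
        congr 1
        simp only [χ, ContinuousMap.coe_mk, ContinuousMap.mul_apply]
        push_cast
        ring
      have h2 : 0 ≤ min 1 (‖f.1 s‖ / δ) := le_min zero_le_one (by positivity)
      have h3 : min 1 (‖f.1 s‖ / δ) ≤ 1 := min_le_left _ _
      rw [h1, norm_smul, Complex.norm_real, Real.norm_of_nonneg (by nlinarith)]
      rcases le_total (‖f.1 s‖) δ with hle | hle
      · exact (mul_le_of_le_one_left (norm_nonneg _) (by nlinarith)).trans hle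
      · rw [min_eq_left ((one_le_div hδ).2 hle)]
        simpa using hδ.le
    have h4 : L f - L (centralTrace f) = L g - L (centralTrace g) := by
      have h5 := congrArg L hfg
      have h6 := congrArg (fun f => L (centralTrace f)) hfg
      simp only [centralTrace_add, map_add] at h5 h6
      rw [h5, h6, tracial_central_mul L hL χ hχ0 hχ1, add_sub_add_left_eq_sub]
    rw [dist_eq_norm, h4]
    refine (norm_sub_le _ _).trans (le_trans (add_le_add ?_ ?_) hδε)
    · exact (hC g).trans (by gcongr)
    · exact (hC _).trans (by gcongr; exact (norm_centralTrace_le g).trans hg)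
  have hp : (p : ℂ) ≠ 0 := NeZero.ne _
  have hq : (q : ℂ) ≠ 0 := NeZero.ne _
  -- The corrections `(1 - s)² • (c (f 0) ⊗ 1)` and `s² • (1 ⊗ c (f 1))` match `f` at the endpoints;
  -- squares appear because the trace lemmas for the ends factor the scalar function as `g * g`.
  let gl : C(I, ℂ) := ⟨fun s => (1 - (s : ℝ) : ℂ), by fun_prop⟩
  let gr : C(I, ℂ) := ⟨fun s => ((s : ℝ) : ℂ), by fun_prop⟩
  have hl : gl 1 = 0 := by simp [gl]
  have hr : gr 0 = 0 := by simp [gr]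
  let fl := leftElt (q := q) (gl * gl) (by simp [hl]) (leftEnd f)
  let fr := rightElt (p := p) (gr * gr) (by simp [hr]) (rightEnd f)
  obtain ⟨g, hfg, hgs⟩ : ∃ g : DimDrop p q, f = g + (fl + fr) ∧
      ∀ s, g.1 s = f.1 s - (fl.1 s + fr.1 s) :=
    ⟨f - (fl + fr), DimDrop.ext fun s => by
      rw [DimDrop.add_apply, DimDrop.sub_apply, sub_add_cancel], fun s => rfl⟩
  have hg : L g = L (centralTrace g) := by
    refine key g ?_ ?_
    · rw [hgs]
      simp [fl, fr, leftElt_apply, rightElt_apply, gl, gr, leftEnd_kronecker_one f]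
    · rw [hgs]
      simp [fl, fr, leftElt_apply, rightElt_apply, gl, gr, one_kronecker_rightEnd f]
  have hfl : L fl = L (centralTrace fl) := by
    rw [tracial_leftElt L hL gl hl, ← smul_eq_mul, ← map_smul]
    congr 1
    refine DimDrop.ext fun s => ?_
    rw [DimDrop.smul_apply, centralTrace_apply, normTrace_apply, leftElt_apply, leftElt_apply,
      Matrix.trace_smul, Matrix.trace_kronecker, Matrix.trace_one, Fintype.card_fin,
      Matrix.one_kronecker_one, smul_smul, smul_eq_mul]
    congr 1
    field_simp
  have hfr : L fr = L (centralTrace fr) := by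
    rw [tracial_rightElt L hL gr hr, ← smul_eq_mul, ← map_smul]
    congr 1
    refine DimDrop.ext fun s => ?_
    rw [DimDrop.smul_apply, centralTrace_apply, normTrace_apply, rightElt_apply, rightElt_apply,
      Matrix.trace_smul, Matrix.trace_kronecker, Matrix.trace_one, Fintype.card_fin,
      Matrix.one_kronecker_one, smul_smul, smul_eq_mul]
    congr 1
    field_simp
  have h1 := congrArg L hfg
  have h2 := congrArg (fun f => L (centralTrace f)) hfg
  simp only [centralTrace_add, map_add] at h1 h2
  rw [h1, h2, hg, hfl, hfr]

end Functional

end Traces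

/-! ### Continuity and faithfulness of tracial states -/

section TracialStates

variable {A : Type*} [CStarAlgebra A]

/-- Positivity of a tracial state is phrased through elements `c* c`; this turns the operator
inequality `x ≤ ‖x‖` into that form. -/
theorem exists_star_mul_self_eq_norm_sub {x : A} (hx : IsSelfAdjoint x) :
    ∃ c : A, star c * c = (‖x‖ : ℂ) • 1 - x := by
  let _ := CStarAlgebra.spectralOrder A
  have := CStarAlgebra.spectralOrderedRing A
  have h := sub_nonneg.2 hx.le_algebraMap_norm_self
  obtain ⟨c, hc⟩ := CStarAlgebra.nonneg_iff_eq_star_mul_self.1 h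
  refine ⟨c, hc.symm.trans ?_⟩
  rw [Algebra.algebraMap_eq_smul_one, Complex.coe_smul]

variable {τ : A →ₗ[ℂ] ℂ}

theorem IsTracialState.bound_of_isSelfAdjoint (hτ : IsTracialState τ) {x : A}
    (hx : IsSelfAdjoint x) : (τ x).im = 0 ∧ (τ x).re ≤ ‖x‖ := by
  obtain ⟨c, hc⟩ := exists_star_mul_self_eq_norm_sub hx
  have h := hτ.nonneg c
  rw [hc, map_sub, map_smul, hτ.map_one, smul_eq_mul, mul_one, Complex.sub_re, Complex.sub_im,
    Complex.ofReal_re, Complex.ofReal_im] at h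
  constructor <;> linarith

theorem IsTracialState.norm_le_of_isSelfAdjoint (hτ : IsTracialState τ) {x : A}
    (hx : IsSelfAdjoint x) : ‖τ x‖ ≤ ‖x‖ := by
  obtain ⟨h1, h2⟩ := hτ.bound_of_isSelfAdjoint hx
  obtain ⟨-, h3⟩ := hτ.bound_of_isSelfAdjoint hx.neg
  rw [map_neg, Complex.neg_re, norm_neg] at h3
  rw [← Complex.re_add_im (τ x), h1, Complex.ofReal_zero, zero_mul, add_zero, Complex.norm_real,
    Real.norm_eq_abs, abs_le]
  constructor <;> linarith

/-- Real and imaginary parts are estimated separately, which costs the factor 2; any fixed bound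
serves the applications. -/
theorem IsTracialState.norm_le (hτ : IsTracialState τ) (x : A) : ‖τ x‖ ≤ 2 * ‖x‖ := by
  have h1 := hτ.norm_le_of_isSelfAdjoint (realPart x).2
  have h2 := hτ.norm_le_of_isSelfAdjoint (imaginaryPart x).2
  have h3 : ‖((realPart x : selfAdjoint A) : A)‖ ≤ ‖x‖ := realPart.norm_le x
  have h4 : ‖((imaginaryPart x : selfAdjoint A) : A)‖ ≤ ‖x‖ := imaginaryPart.norm_le x
  rw [← realPart_add_I_smul_imaginaryPart x, map_add, map_smul]
  refine (norm_add_le _ _).trans ?_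
  rw [realPart_add_I_smul_imaginaryPart x, norm_smul, Complex.norm_I, one_mul]
  linarith

theorem IsTracialState.continuous (hτ : IsTracialState τ) : Continuous τ :=
  (τ.mkContinuous 2 hτ.norm_le).continuous

/-- With `c* c = ‖a* a‖ - a* a`, expand `τ ((c x)* (c x)) ≥ 0`. This makes the null space of `τ` a
left ideal. -/
theorem IsTracialState.re_conjugate_le (hτ : IsTracialState τ) (a x : A) :
    (τ (star (a * x) * (a * x))).re ≤ ‖star a * a‖ * (τ (star x * x)).re := by
  obtain ⟨c, hc⟩ := exists_star_mul_self_eq_norm_sub (IsSelfAdjoint.star_mul_self a)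
  have h := (hτ.nonneg (c * x)).1
  have h1 : star (c * x) * (c * x) =
      (‖star a * a‖ : ℂ) • (star x * x) - star (a * x) * (a * x) := by
    calc star (c * x) * (c * x) = star x * (star c * c) * x := by
          rw [star_mul]; simp only [mul_assoc]
      _ = _ := by
          rw [hc, mul_sub, sub_mul, mul_smul_comm, mul_one, smul_mul_assoc, star_mul]
          simp only [mul_assoc]
  rw [h1, map_sub, map_smul, smul_eq_mul, Complex.sub_re, Complex.re_ofReal_mul] at h
  linarith

theorem IsTracialState.map_star_mul_self_eq_zero_iff (hτ : IsTracialState τ) (x : A) :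
    τ (star x * x) = 0 ↔ (τ (star x * x)).re ≤ 0 := by
  refine ⟨fun h => by rw [h, Complex.zero_re], fun h => ?_⟩
  exact Complex.ext (le_antisymm h (hτ.nonneg x).1) (hτ.nonneg x).2

/-- Tracial states of simple C*-algebras are faithful. -/
theorem IsTracialState.eq_zero_of_isSimple (hτ : IsTracialState τ) (hA : IsSimpleCStarAlgebra A)
    {x : A} (hx : τ (star x * x) = 0) : x = 0 := by
  have hleft : ∀ a y : A, τ (star y * y) = 0 → τ (star (a * y) * (a * y)) = 0 := by
    intro a y hy
    rw [hτ.map_star_mul_self_eq_zero_iff]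
    have := hτ.re_conjugate_le a y
    rwa [hy, Complex.zero_re, mul_zero] at this
  have hstar : ∀ y : A, τ (star y * y) = 0 → τ (star (star y) * star y) = 0 := by
    intro y hy
    rw [star_star, hτ.trace, hy]
  let J : TwoSidedIdeal A := TwoSidedIdeal.mk' {y | τ (star y * y) = 0} (by simp)
    (by
      intro y z hy hz
      rw [Set.mem_ofPred_eq] at hy hz ⊢
      rw [hτ.map_star_mul_self_eq_zero_iff]
      -- The parallelogram identity replaces the Cauchy–Schwarz inequality.
      have h1 : star (y + z) * (y + z) + star (y - z) * (y - z) =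
          (2 : ℂ) • (star y * y) + (2 : ℂ) • (star z * z) := by
        rw [star_add, star_sub, two_smul, two_smul]
        noncomm_ring
      have h2 := congrArg τ h1
      rw [map_add, map_add, map_smul, map_smul, hy, hz, smul_zero, add_zero] at h2
      have h3 := congrArg Complex.re h2
      rw [Complex.add_re, Complex.zero_re] at h3
      linarith [(hτ.nonneg (y - z)).1])
    (by
      intro y hy
      rw [Set.mem_ofPred_eq] at hy ⊢
      rw [star_neg, neg_mul_neg, hy])
    (fun {a y} hy => hleft a y hy)
    (by
      -- The trace property makes the null space invariant under `star`, which turns right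
      -- multiplication into left multiplication.
      intro y a hy
      have := hstar _ (hleft (star a) _ (hstar y hy))
      rwa [star_mul, star_star, star_star] at this)
  have hJ : (J : Set A) = {y | τ (star y * y) = 0} := TwoSidedIdeal.coe_mk' _ _ _ _ _ _
  have hc : IsClosed (J : Set A) := by
    rw [hJ]
    have := hτ.continuous
    exact isClosed_eq (by fun_prop) continuous_const
  have hxJ : x ∈ J := by
    have : x ∈ (J : Set A) := by rw [hJ]; exact hx
    exact this
  rcases hA.2 J hc with h | h
  · rw [h] at hxJ
    exact (TwoSidedIdeal.mem_bot A).1 hxJ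
  · have h1 : (1 : A) ∈ (J : Set A) := by rw [h]; trivial
    rw [hJ, Set.mem_ofPred_eq, star_one, mul_one, hτ.map_one] at h1
    exact absurd h1 one_ne_zero

end TracialStates

/-! ### Tracial states of the inductive limit -/

section LimitTraces

variable {p q : ℕ}

theorem normTrace_add (f g : DimDrop p q) (s : I) :
    normTrace (f + g) s = normTrace f s + normTrace g s := by
  rw [normTrace_apply, DimDrop.add_apply, Matrix.trace_add, add_div]; rfl

theorem normTrace_smul (r : ℂ) (f : DimDrop p q) (s : I) :
    normTrace (r • f) s = r * normTrace f s := by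
  rw [normTrace_apply, DimDrop.smul_apply, Matrix.trace_smul, smul_eq_mul, mul_div_assoc]; rfl

theorem normTrace_mul_comm (f g : DimDrop p q) (s : I) :
    normTrace (f * g) s = normTrace (g * f) s := by
  rw [normTrace_apply, DimDrop.mul_apply, Matrix.trace_mul_comm]; rfl

open scoped ComplexOrder in
theorem normTrace_star_mul_self (f : DimDrop p q) (s : I) :
    0 ≤ (normTrace (star f * f) s).re ∧ (normTrace (star f * f) s).im = 0 := by
  have h1 : 0 ≤ (star (f.1 s) * f.1 s).trace :=
    (Matrix.posSemidef_conjTranspose_mul_self (f.1 s)).trace_nonneg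
  have h2 : 0 ≤ normTrace (star f * f) s := by
    rw [normTrace_apply, DimDrop.mul_apply, DimDrop.star_apply]
    refine div_nonneg h1 ?_
    exact_mod_cast Nat.zero_le (p * q)
  rw [Complex.nonneg_iff] at h2
  exact ⟨h2.1, h2.2.symm⟩

theorem normTrace_one [NeZero p] [NeZero q] (s : I) : normTrace (1 : DimDrop p q) s = 1 := by
  have hp : (p : ℂ) ≠ 0 := NeZero.ne _
  have hq : (q : ℂ) ≠ 0 := NeZero.ne _
  rw [normTrace_apply, DimDrop.one_apply, Matrix.trace_one, Fintype.card_prod, Fintype.card_fin,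
    Fintype.card_fin, Nat.cast_mul, div_self (mul_ne_zero hp hq)]

variable {p q : ℕ → ℕ} [∀ n, NeZero (p n)] [∀ n, NeZero (q n)]
  (S : CStarSystem (fun n => DimDrop (p n) (q n)))

open CStarSystem

/-- Limits of normalized traces at points `s n` are tracial states of the inductive limit. -/
theorem exists_tracialState_of_ultrafilter (s : ℕ → I) (ω : Ultrafilter ℕ)
    (hω : (ω : Filter ℕ) ≤ atTop) :
    ∃ τ : S.Limit →ₗ[ℂ] ℂ, IsTracialState τ ∧ ∀ x : S.PreLimit,
      Tendsto (fun n => normTrace (x.entry n) (s n)) ω (𝓝 (τ x.toLimit)) := by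
  -- The traces eventually lie in a compact ball, and an ultrafilter gives limits for all `x` at
  -- once, so no subsequences need be chosen.
  have hex : ∀ x : S.PreLimit, ∃ z : ℂ, Tendsto (fun n => normTrace (x.entry n) (s n)) ω (𝓝 z) := by
    intro x
    have h1 : ∀ᶠ n in (ω : Filter ℕ), normTrace (x.entry n) (s n) ∈
        Metric.closedBall (0 : ℂ) (‖x‖ + 1) := by
      filter_upwards [hω ((PreLimit.tendsto_norm x).eventually_le_const (lt_add_one _))] with n hn
      rw [mem_closedBall_zero_iff]
      exact (norm_normTrace_le _ _).trans ((DimDrop.norm_apply_le _ _).trans hn)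
    obtain ⟨z, -, hz⟩ := (isCompact_closedBall (0 : ℂ) (‖x‖ + 1)).ultrafilter_le_nhds
      (ω.map fun n => normTrace (x.entry n) (s n)) (by
        rw [Ultrafilter.coe_map, le_principal_iff]; exact h1)
    exact ⟨z, hz⟩
  choose L hL using hex
  have hnorm : ∀ x, ‖L x‖ ≤ 1 * ‖x‖ := by
    intro x
    rw [one_mul]
    refine le_of_tendsto_of_tendsto (hL x).norm ((PreLimit.tendsto_norm x).mono_left hω) ?_
    exact Eventually.of_forall fun n =>
      (norm_normTrace_le _ _).trans (DimDrop.norm_apply_le _ _)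
  let Ll : S.PreLimit →ₗ[ℂ] ℂ :=
    { toFun := L
      map_add' := fun x y => tendsto_nhds_unique (hL (x + y)) <|
        ((hL x).add (hL y)).congr fun n => (normTrace_add (x.entry n) (y.entry n) (s n)).symm
      map_smul' := fun r x => tendsto_nhds_unique (hL (r • x)) <|
        ((hL x).const_mul r).congr fun n => (normTrace_smul r (x.entry n) (s n)).symm }
  let Lc := Ll.mkContinuous 1 hnorm
  let T : S.Limit → ℂ := UniformSpace.Completion.extension (α := S.PreLimit) Lc
  have hT : ∀ x : S.PreLimit, T x.toLimit = L x := fun x =>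
    UniformSpace.Completion.extension_coe Lc.uniformContinuous x
  have hTc : Continuous T := UniformSpace.Completion.continuous_extension
  let τ : S.Limit →ₗ[ℂ] ℂ :=
    { toFun := T
      map_add' := fun x y => by
        refine Limit.ind (P := fun x => T (x + y) = T x + T y) x
          (isClosed_eq (by fun_prop) (by fun_prop)) fun a => ?_
        refine Limit.ind (P := fun y => T (a.toLimit + y) = T a.toLimit + T y) y
          (isClosed_eq (by fun_prop) (by fun_prop)) fun b => ?_
        rw [← Limit.toLimit_add, hT, hT, hT]
        exact Ll.map_add a b
      map_smul' := fun r x => by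
        have h : Continuous fun y : S.Limit => r • y := continuous_const_smul r
        refine Limit.ind (P := fun x => T (r • x) = r • T x) x
          (isClosed_eq (hTc.comp h) (by fun_prop)) fun a => ?_
        rw [← Limit.toLimit_smul, hT, hT]
        exact Ll.map_smul r a }
  have hτ : ∀ x : S.PreLimit, τ x.toLimit = L x := hT
  have hτc : Continuous τ := hTc
  refine ⟨τ, ⟨?_, fun x => ?_, fun x y => ?_⟩, fun x => by rw [hτ]; exact hL x⟩
  · refine (hτ 1).trans (tendsto_nhds_unique (hL 1) ?_)
    exact tendsto_const_nhds.congr fun n => (normTrace_one (s n)).symm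
  · refine Limit.ind (P := fun x => 0 ≤ (τ (star x * x)).re ∧ (τ (star x * x)).im = 0) x ?_
      fun a => ?_
    · have h1 : Continuous fun x => τ (star x * x) := by fun_prop
      exact (isClosed_le continuous_const (Complex.continuous_re.comp h1)).inter
        (isClosed_eq (Complex.continuous_im.comp h1) continuous_const)
    · rw [← Limit.toLimit_star, ← Limit.toLimit_mul, hτ]
      have h1 := hL (star a * a)
      have h2 := fun n => normTrace_star_mul_self (a.entry n) (s n)
      exact ⟨ge_of_tendsto' ((Complex.continuous_re.tendsto _).comp h1) fun n => (h2 n).1,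
        tendsto_nhds_unique ((Complex.continuous_im.tendsto _).comp h1)
          (tendsto_const_nhds.congr fun n => (h2 n).2.symm)⟩
  · refine Limit.ind (P := fun x => τ (x * y) = τ (y * x)) x
      (isClosed_eq (by fun_prop) (by fun_prop)) fun a => ?_
    refine Limit.ind (P := fun y => τ (a.toLimit * y) = τ (y * a.toLimit)) y
      (isClosed_eq (by fun_prop) (by fun_prop)) fun b => ?_
    rw [← Limit.toLimit_mul, ← Limit.toLimit_mul, hτ, hτ]
    exact tendsto_nhds_unique (hL (a * b)) <|
      (hL (b * a)).congr fun n => normTrace_mul_comm (b.entry n) (a.entry n) (s n)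

theorem exists_tracialState : ∃ τ : S.Limit →ₗ[ℂ] ℂ, IsTracialState τ := by
  obtain ⟨τ, hτ, -⟩ := exists_tracialState_of_ultrafilter S (fun _ => 0) (Ultrafilter.of atTop)
    (Ultrafilter.of_le atTop)
  exact ⟨τ, hτ⟩

theorem nontrivial_limit : Nontrivial S.Limit := by
  obtain ⟨τ, hτ⟩ := exists_tracialState S
  refine ⟨1, 0, fun h => ?_⟩
  have h1 := hτ.map_one
  rw [h, map_zero] at h1
  exact zero_ne_one h1

end LimitTraces

/-! ### Small variation implies a unique trace -/

section SmallVariation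

theorem exists_pattern_of_variation_lt {p q p' q' : ℕ} [NeZero p] [NeZero q]
    {ι : DimDrop p q →⋆ₐ[ℂ] DimDrop p' q'} {δ : ℝ≥0∞} (h : variation ι < δ) :
    ∃ (a b k : ℕ) (t : Fin k → C(I, I)), IsEigenvaluePattern ι a b t ∧
      ∀ i s s', edist (t i s) (t i s') < δ := by
  simp only [variation, iInf_lt_iff] at h
  obtain ⟨k, t, ⟨⟨a, b, ht⟩, -⟩, hlt⟩ := h
  refine ⟨a, b, k, t, ht, fun i s s' => lt_of_le_of_lt ?_ hlt⟩
  exact (Metric.edist_le_ediam_of_mem (Set.mem_range_self s) (Set.mem_range_self s')).trans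
    (le_iSup (fun i => Metric.ediam (Set.range (t i))) i)

theorem IsTracialState.map_hom_centralTrace {B : Type*} [CStarAlgebra B] {κ : B →ₗ[ℂ] ℂ}
    (hκ : IsTracialState κ) {p q : ℕ} [NeZero p] [NeZero q] (Φ : DimDrop p q →⋆ₐ[ℂ] B)
    (f : DimDrop p q) : κ (Φ f) = κ (Φ (centralTrace f)) := by
  let L : DimDrop p q →ₗ[ℂ] ℂ :=
    { toFun := fun f => κ (Φ f)
      map_add' := fun a b => by rw [map_add, map_add]
      map_smul' := fun r a => by rw [map_smul, map_smul, RingHom.id_apply] }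
  refine tracial_eq_centralTrace L (fun a b => ?_) (C := 2) (fun a => ?_) f
  · change κ (Φ (a * b)) = κ (Φ (b * a))
    rw [map_mul Φ, map_mul Φ, hκ.trace]
  · exact (hκ.norm_le _).trans (by gcongr; exact DimDrop.norm_map_le Φ a)

theorem IsTracialState.map_hom_eq {B : Type*} [CStarAlgebra B] {κ : B →ₗ[ℂ] ℂ}
    (hκ : IsTracialState κ) {p q : ℕ} [NeZero p] [NeZero q] (Φ : DimDrop p q →⋆ₐ[ℂ] B)
    {f e : DimDrop p q} {c : ℂ} (he : centralTrace f = c • 1 + e) :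
    κ (Φ f) = c + κ (Φ e) := by
  have h1 : Φ 1 = 1 := _root_.map_one Φ
  rw [hκ.map_hom_centralTrace Φ, he, map_add, map_add, map_smul, map_smul, h1, hκ.map_one,
    smul_eq_mul, mul_one]

variable {p q : ℕ → ℕ} [∀ n, NeZero (p n)] [∀ n, NeZero (q n)]
  {S : CStarSystem (fun n => DimDrop (p n) (q n))}

/-- If the variations tend to zero, the values of the images of a given element eventually become
nearly constant up to unitary equivalence. -/
theorem eventually_nearly_constant
    (hV : ∀ m : ℕ, Tendsto (fun n : Set.Ici m => variation (S.map n.2)) atTop (𝓝 0))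
    {m : ℕ} (f : DimDrop (p m) (q m)) {r : ℝ} (hr : 0 < r) :
    ∀ᶠ n in atTop, ∀ h : m ≤ n, ∀ s s' : I,
      ∃ u ∈ Matrix.unitaryGroup (Fin (p n) × Fin (q n)) ℂ,
        ‖(S.map h f).1 s - u * (S.map h f).1 s' * star u‖ ≤ r := by
  have huc : UniformContinuous f.1 := CompactSpace.uniformContinuous_of_continuous f.1.continuous
  obtain ⟨δ, hδ, hδf⟩ := EMetric.uniformContinuous_iff.1 huc (ENNReal.ofReal r)
    (ENNReal.ofReal_pos.2 hr)
  have h1 : ∀ᶠ n : Set.Ici m in atTop, variation (S.map n.2) < δ :=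
    (hV m).eventually_lt_const hδ
  obtain ⟨N, hN⟩ := eventually_atTop.1 h1
  filter_upwards [eventually_ge_atTop N.1] with n hn h s s'
  obtain ⟨a, b, k, t, ht, htδ⟩ := exists_pattern_of_variation_lt (hN ⟨n, h⟩ hn)
  refine ht.exists_unitary_norm_sub_le f s s' hr.le fun i => ?_
  have h2 := hδf (htδ i s s')
  rw [edist_dist, ENNReal.ofReal_lt_ofReal_iff hr, dist_eq_norm] at h2
  exact h2.le

/-- At a late stage the normalized trace of the image of `f` is nearly a constant, and every tracial
state of the limit must take nearly this value on the class of `f`. -/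
theorem isMonotracial_of_variation_tendsto
    (hV : ∀ m : ℕ, Tendsto (fun n : Set.Ici m => variation (S.map n.2)) atTop (𝓝 0)) :
    IsMonotracial S.Limit := by
  obtain ⟨τ, hτ⟩ := exists_tracialState S
  refine ⟨τ, hτ, fun τ' hτ' => LinearMap.ext fun x => ?_⟩
  have hc := hτ.continuous
  have hc' := hτ'.continuous
  refine Limit.ind_incl (P := fun x => τ' x = τ x) x (isClosed_eq hc' hc) fun m f => ?_
  refine eq_of_forall_dist_le fun ε hε => ?_
  obtain ⟨n, hn, hmn⟩ := ((eventually_nearly_constant hV f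
    (r := ε / 4) (by positivity)).and (eventually_ge_atTop m)).exists
  set g : DimDrop (p n) (q n) := S.map hmn f with hg
  have hnear : ∀ s, ‖normTrace g s - normTrace g 0‖ ≤ ε / 4 := by
    intro s
    obtain ⟨u, hu, hus⟩ := hn hmn s 0
    have h1 := norm_trace_le (g.1 s - u * g.1 0 * star u)
    rw [Matrix.trace_sub, Matrix.trace_mul_cycle, (Matrix.mem_unitaryGroup_iff').1 hu, one_mul,
      Fintype.card_prod, Fintype.card_fin, Fintype.card_fin, Nat.cast_mul] at h1
    have hp : (0 : ℝ) < p n * q n := by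
      exact_mod_cast Nat.mul_pos (NeZero.pos (p n)) (NeZero.pos (q n))
    rw [normTrace_apply, normTrace_apply, ← sub_div, norm_div, norm_mul, Complex.norm_natCast,
      Complex.norm_natCast, div_le_iff₀ hp, mul_comm]
    exact h1.trans (by gcongr)
  -- The deviation from the constant has norm at most `ε / 4`; the factor 2 of
  -- `IsTracialState.norm_le` and the two states bring the total to `ε`.
  obtain ⟨e, he, hes⟩ : ∃ e : DimDrop (p n) (q n), centralTrace g = normTrace g 0 • 1 + e ∧
      ∀ s, e.1 s = (normTrace g s - normTrace g 0) • 1 :=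
    ⟨centralTrace g - normTrace g 0 • 1, DimDrop.ext fun s => by
      rw [DimDrop.add_apply, DimDrop.sub_apply, add_sub_cancel], fun s => by
      rw [DimDrop.sub_apply, centralTrace_apply, sub_smul]; rfl⟩
  have hen : ‖e‖ ≤ ε / 4 := by
    refine DimDrop.norm_le (by positivity) fun s => ?_
    rw [hes, norm_smul, norm_one, mul_one]
    exact hnear s
  have key : ∀ κ : S.Limit →ₗ[ℂ] ℂ, IsTracialState κ →
      κ (S.incl m f) = normTrace g 0 + κ (S.incl n e) := by
    intro κ hκ
    rw [← incl_map hmn]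
    exact (hκ.map_hom_eq (S.incl n) he)
  have hbound : ∀ κ : S.Limit →ₗ[ℂ] ℂ, IsTracialState κ → ‖κ (S.incl n e)‖ ≤ ε / 2 := by
    intro κ hκ
    refine (hκ.norm_le _).trans ?_
    have := (DimDrop.norm_map_le (S.incl n) e).trans hen
    linarith
  rw [dist_eq_norm, key τ hτ, key τ' hτ', add_sub_add_left_eq_sub]
  refine (norm_sub_le _ _).trans ?_
  linarith [hbound τ hτ, hbound τ' hτ']

end SmallVariation

/-! ### Simple and monotracial implies small variation -/

section Necessity

/-- The decreasing piecewise linear function that is `1` up to `c` and `0` from `d` on. -/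
def ramp (c d : ℝ) : C(I, ℝ) := ⟨fun w => min 1 (max 0 ((d - w) / (d - c))), by fun_prop⟩

theorem ramp_nonneg (c d : ℝ) (w : I) : 0 ≤ ramp c d w := le_min zero_le_one (le_max_left _ _)

theorem ramp_le_one (c d : ℝ) (w : I) : ramp c d w ≤ 1 := min_le_left _ _

theorem ramp_eq_one {c d : ℝ} (h : c < d) {w : I} (hw : (w : ℝ) ≤ c) : ramp c d w = 1 := by
  have h1 : 1 ≤ (d - w) / (d - c) := by rw [one_le_div (by linarith)]; linarith
  simp only [ramp, ContinuousMap.coe_mk]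
  rw [max_eq_right (by linarith), min_eq_left h1]

theorem ramp_eq_zero {c d : ℝ} (h : c < d) {w : I} (hw : d ≤ w) : ramp c d w = 0 := by
  have h1 : (d - w) / (d - c) ≤ 0 := div_nonpos_of_nonpos_of_nonneg (by linarith) (by linarith)
  simp [ramp, max_eq_left h1]

/-- A real function as a central element. -/
def realCentral {p q : ℕ} (g : C(I, ℝ)) : DimDrop p q :=
  central ⟨fun w => (g w : ℂ), by fun_prop⟩

theorem realCentral_apply {p q : ℕ} (g : C(I, ℝ)) (s : I) :
    (realCentral g : DimDrop p q).1 s = (g s : ℂ) • 1 := rfl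

theorem star_mul_self_realCentral_add {p q : ℕ} {g g₁ g₂ : C(I, ℝ)}
    (h : ∀ s, g s * g s + g₁ s = g₂ s) :
    star (realCentral g : DimDrop p q) * realCentral g + realCentral g₁ = realCentral g₂ := by
  refine DimDrop.ext fun s => ?_
  rw [DimDrop.add_apply, DimDrop.mul_apply, DimDrop.star_apply, realCentral_apply,
    realCentral_apply, realCentral_apply, star_smul, star_one, smul_mul_smul_comm, mul_one,
    ← add_smul, Complex.star_def, Complex.conj_ofReal, ← h]
  push_cast
  rfl

/-- A pattern with large variation has a point at which an eigenvalue function is much smaller than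
at another one. -/
theorem exists_spread_of_lt_variation {p q p' q' : ℕ} [NeZero p] [NeZero q] (hpq : p.Coprime q)
    {ι : DimDrop p q →⋆ₐ[ℂ] DimDrop p' q'} {ε : ℝ} (h : ENNReal.ofReal ε < variation ι) :
    ∃ (a b k : ℕ) (t : Fin k → C(I, I)), IsEigenvaluePattern ι a b t ∧
      (∀ i j, i ≤ j → ∀ s, t i s ≤ t j s) ∧
      ∃ i s s', (t i s : ℝ) + ε ≤ t i s' := by
  -- Existence matters: without a pattern the infimum would be `∞` and a large variation would carry
  -- no information.
  obtain ⟨k, t, ht⟩ := exists_isNormalizedPattern hpq ι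
  have h1 : variation ι ≤ patternVariation t :=
    iInf_le_of_le k (iInf_le_of_le t (iInf_le_of_le ht le_rfl))
  obtain ⟨i, hi⟩ := lt_iSup_iff.1 (h.trans_le h1)
  obtain ⟨s, s', hs⟩ : ∃ s s', ENNReal.ofReal ε < edist (t i s) (t i s') := by
    by_contra! hcon
    refine absurd hi (not_lt.2 (Metric.ediam_le ?_))
    rintro _ ⟨s, rfl⟩ _ ⟨s', rfl⟩
    exact hcon s s'
  rw [edist_dist] at hs
  have hs' := (ENNReal.ofReal_lt_ofReal_iff'.1 hs).1
  rw [Subtype.dist_eq, Real.dist_eq] at hs'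
  obtain ⟨⟨a, b, hab⟩, hmono⟩ := ht
  refine ⟨a, b, k, t, hab, hmono, i, ?_⟩
  rcases lt_abs.1 hs' with hlt | hlt
  · exact ⟨s', s, by linarith⟩
  · exact ⟨s, s', by linarith⟩

theorem normTrace_realCentral {p q p' q' : ℕ} [NeZero p] [NeZero q]
    {ι : DimDrop p q →⋆ₐ[ℂ] DimDrop p' q'} {a b k : ℕ} {t : Fin k → C(I, I)}
    (h : IsEigenvaluePattern ι a b t) (g : C(I, ℝ)) (s : I) :
    (normTrace (ι (realCentral g)) s).re =
      ((a * p) * g 0 + (p * q) * ∑ i, g (t i s) + (b * q) * g 1) / (p' * q') := by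
  rw [normTrace_apply, realCentral, h.trace_central]
  rw [← Complex.ofReal_re (((a * p) * g 0 + (p * q) * ∑ i, g (t i s) + (b * q) * g 1) / (p' * q'))]
  push_cast
  rfl

/-- If an eigenvalue function passes from below `x` to above `y`, the traces of cut-off functions
at the two points compare in the wrong order. -/
theorem normTrace_ramp_le {p q p' q' : ℕ} [NeZero p] [NeZero q]
    {ι : DimDrop p q →⋆ₐ[ℂ] DimDrop p' q'} {a b k : ℕ} {t : Fin k → C(I, I)}
    (h : IsEigenvaluePattern ι a b t) (hmono : ∀ i j, i ≤ j → ∀ s, t i s ≤ t j s)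
    {x z y : ℝ} (hxz : x < z) (hzy : z < y) {i : Fin k} {s s' : I}
    (hs : (t i s : ℝ) < x) (hs' : y < t i s') :
    (normTrace (ι (realCentral (ramp z y))) s').re ≤
      (normTrace (ι (realCentral (ramp x z))) s).re := by
  have hx0 : 0 ≤ x := (t i s).2.1.trans hs.le
  have hy1 : y ≤ 1 := hs'.le.trans (t i s').2.2
  rw [normTrace_realCentral h, normTrace_realCentral h]
  -- Both ramps are 1 at the left endpoint and 0 at the right one, so the end blocks contribute
  -- equally and only the eigenvalue sums are compared.
  rw [ramp_eq_one hzy (w := 0) (by simpa using hx0.trans hxz.le),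
    ramp_eq_one hxz (w := 0) (by simpa using hx0), ramp_eq_zero hzy (w := 1) (by simpa using hy1),
    ramp_eq_zero hxz (w := 1) (by simpa using hzy.le.trans hy1)]
  -- At `s'` the eigenvalues from index `i` on exceed `y` and contribute nothing; at `s` those
  -- before `i` lie below `x` and contribute 1 each. Both sums are compared with the number of
  -- indices before `i`.
  have h1 : ∑ j, ramp z y (t j s') ≤ (Finset.Iio i).card := by
    rw [← Finset.sum_subset (Finset.subset_univ (Finset.Iio i)) fun j _ hj =>
      ramp_eq_zero hzy (hs'.le.trans (hmono i j (not_lt.1 fun h => hj (Finset.mem_Iio.2 h)) s'))]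
    exact (Finset.sum_le_sum fun j _ => ramp_le_one _ _ _).trans (by simp)
  have h2 : ((Finset.Iio i).card : ℝ) ≤ ∑ j, ramp x z (t j s) := by
    calc ((Finset.Iio i).card : ℝ) = ∑ j ∈ Finset.Iio i, ramp x z (t j s) := by
          rw [Finset.sum_congr rfl fun j hj => ramp_eq_one hxz
            (le_trans (hmono j i (Finset.mem_Iio.1 hj).le s) hs.le)]
          simp
      _ ≤ ∑ j, ramp x z (t j s) :=
          Finset.sum_le_sum_of_subset_of_nonneg (Finset.subset_univ _) fun _ _ _ =>
            ramp_nonneg _ _ _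
  have h3 := mul_le_mul_of_nonneg_left (h1.trans h2) (by positivity : (0 : ℝ) ≤ p * q)
  exact div_le_div_of_nonneg_right (by linarith) (by positivity)

variable {p q : ℕ → ℕ} [∀ n, NeZero (p n)] [∀ n, NeZero (q n)]
  {S : CStarSystem (fun n => DimDrop (p n) (q n))}

theorem tendsto_variation_of_isSimple_of_isMonotracial (hpq : ∀ n, Nat.Coprime (p n) (q n))
    (hsimple : IsSimpleCStarAlgebra S.Limit) (hmono : IsMonotracial S.Limit) (m : ℕ) :
    Tendsto (fun n : Set.Ici m => variation (S.map n.2)) atTop (𝓝 0) := by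
  by_contra hcon
  rw [ENNReal.tendsto_nhds_zero] at hcon
  push Not at hcon
  obtain ⟨ε₀, hε₀, hfreq⟩ := hcon
  obtain ⟨ε, hε, hεε₀⟩ : ∃ ε : ℝ, 0 < ε ∧ ENNReal.ofReal ε ≤ ε₀ := by
    obtain ⟨r, hr0, hr⟩ := ENNReal.lt_iff_exists_nnreal_btwn.1 hε₀
    exact ⟨r, by exact_mod_cast hr0, by rw [ENNReal.ofReal_coe_nnreal]; exact hr.le⟩
  -- the relation recording a spread of an eigenvalue function at the stage `n`
  let Q : ℕ → I → I → I → I → Prop := fun n s s' lo hi =>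
    ∃ (h : m ≤ n) (a b k : ℕ) (t : Fin k → C(I, I)) (i : Fin k),
      IsEigenvaluePattern (S.map h) a b t ∧ (∀ i j, i ≤ j → ∀ s, t i s ≤ t j s) ∧
      (lo : ℝ) + ε ≤ hi ∧ t i s = lo ∧ t i s' = hi
  have hQ : ∃ᶠ n in atTop, ∃ s s' lo hi, Q n s s' lo hi := by
    rw [frequently_atTop] at hfreq ⊢
    intro N
    obtain ⟨n, hn, hlt⟩ := hfreq ⟨max N m, Set.mem_Ici.2 (le_max_right _ _)⟩
    obtain ⟨a, b, k, t, ht, htm, i, s, s', hss⟩ :=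
      exists_spread_of_lt_variation (hpq m) (hεε₀.trans_lt hlt)
    exact ⟨n.1, (le_max_left N m).trans hn, s, s', _, _, n.2, a, b, k, t, i, ht, htm, hss,
      rfl, rfl⟩
  have hne : (atTop ⊓ 𝓟 {n | ∃ s s' lo hi, Q n s s' lo hi} : Filter ℕ).NeBot :=
    frequently_iff_neBot.1 hQ
  let ω := Ultrafilter.of (atTop ⊓ 𝓟 {n | ∃ s s' lo hi, Q n s s' lo hi})
  have hω : (ω : Filter ℕ) ≤ atTop := (Ultrafilter.of_le _).trans inf_le_left
  have hωQ : ∀ᶠ n in (ω : Filter ℕ), ∃ s s' lo hi, Q n s s' lo hi :=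
    (Ultrafilter.of_le _).trans inf_le_right (mem_principal_self _)
  -- The zeros are placeholders at stages without a spread; `ω` is concentrated on the others.
  have hchoose : ∀ n, ∃ s s' lo hi : I, (∃ s s' lo hi, Q n s s' lo hi) → Q n s s' lo hi := by
    intro n
    by_cases h : ∃ s s' lo hi, Q n s s' lo hi
    · obtain ⟨s, s', lo, hi, h'⟩ := h
      exact ⟨s, s', lo, hi, fun _ => h'⟩
    · exact ⟨0, 0, 0, 0, fun h' => absurd h' h⟩
  choose s s' lo hi hs using hchoose
  replace hωQ : ∀ᶠ n in (ω : Filter ℕ), Q n (s n) (s' n) (lo n) (hi n) :=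
    hωQ.mono fun n hn => hs n hn
  obtain ⟨lo', -, hlo⟩ := isCompact_univ.ultrafilter_le_nhds (ω.map lo) (by simp)
  obtain ⟨hi', -, hhi⟩ := isCompact_univ.ultrafilter_le_nhds (ω.map hi) (by simp)
  replace hlo : Tendsto (fun n => (lo n : ℝ)) ω (𝓝 lo') :=
    (continuous_subtype_val.tendsto lo').comp hlo
  replace hhi : Tendsto (fun n => (hi n : ℝ)) ω (𝓝 hi') :=
    (continuous_subtype_val.tendsto hi').comp hhi
  have hgap : (lo' : ℝ) + ε ≤ hi' :=
    le_of_tendsto_of_tendsto (hlo.add_const ε) hhi (hωQ.mono fun n hn => by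
      obtain ⟨_, _, _, _, _, _, _, _, h, _⟩ := hn
      exact h)
  have hlo0 := lo'.2.1
  have hhi1 := hi'.2.2
  -- Three fixed points strictly between the limits `lo'` and `hi'`, so that for `ω`-almost all `n`
  -- the eigenvalue function runs from below `x` to above `y`.
  obtain ⟨x, hx⟩ : ∃ x : ℝ, x = lo' + ε / 4 := ⟨_, rfl⟩
  obtain ⟨z, hz⟩ : ∃ z : I, (z : ℝ) = lo' + ε / 2 :=
    ⟨⟨lo' + ε / 2, by linarith, by linarith⟩, rfl⟩
  obtain ⟨y, hy⟩ : ∃ y : ℝ, y = lo' + 3 * ε / 4 := ⟨_, rfl⟩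
  have hxz : x < z := by linarith
  have hzy : (z : ℝ) < y := by linarith
  have hlox : ∀ᶠ n in (ω : Filter ℕ), (lo n : ℝ) < x := hlo.eventually_lt_const (by linarith)
  have hhiy : ∀ᶠ n in (ω : Filter ℕ), y < (hi n : ℝ) := hhi.eventually_const_lt (by linarith)
  -- the two limit traces agree
  obtain ⟨τ, hτ, hτl⟩ := exists_tracialState_of_ultrafilter S s ω hω
  obtain ⟨τ', hτ', hτl'⟩ := exists_tracialState_of_ultrafilter S s' ω hω
  obtain rfl : τ = τ' := hmono.unique hτ hτ'
  have hle : (τ (S.incl m (realCentral (ramp z y)))).re ≤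
      (τ (S.incl m (realCentral (ramp x z)))).re := by
    have h1 := (Complex.continuous_re.tendsto _).comp
      (hτl' (S.preIncl m (realCentral (ramp z y))))
    have h2 := (Complex.continuous_re.tendsto _).comp
      (hτl (S.preIncl m (realCentral (ramp x z))))
    refine le_of_tendsto_of_tendsto h1 h2 ?_
    filter_upwards [hωQ, hlox, hhiy] with n hn hn1 hn2
    obtain ⟨h, a, b, k, t, i, ht, htm, -, e1, e2⟩ := hn
    simp only [Function.comp_apply, entry_preIncl h]
    rw [← e1] at hn1
    rw [← e2] at hn2
    exact normTrace_ramp_le ht htm hxz hzy hn1 hn2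
  -- The square root puts the difference of the ramps into the form `g* g` required for
  -- faithfulness.
  let g : C(I, ℝ) := ⟨fun w => Real.sqrt (ramp z y w - ramp x z w), by fun_prop⟩
  have hrr : ∀ w : I, 0 ≤ ramp z y w - ramp x z w := by
    intro w
    rcases le_total (w : ℝ) z with hw | hw
    · rw [ramp_eq_one hzy hw]; linarith [ramp_le_one x z w]
    · rw [ramp_eq_zero hxz hw]; linarith [ramp_nonneg z y w]
  have hgg : star (realCentral g : DimDrop (p m) (q m)) * realCentral g +
      realCentral (ramp x z) = realCentral (ramp z y) :=
    star_mul_self_realCentral_add fun w => by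
      rw [show g w * g w = ramp z y w - ramp x z w from Real.mul_self_sqrt (hrr w), sub_add_cancel]
  have hzero : S.incl m (realCentral g) = 0 := by
    refine hτ.eq_zero_of_isSimple hsimple ?_
    rw [hτ.map_star_mul_self_eq_zero_iff]
    have h2 := congrArg (fun w => (τ w).re) (incl_star_mul_self_add (S := S) hgg)
    simp only [map_add, Complex.add_re] at h2
    linarith
  have hone : 1 ≤ ‖S.incl m (realCentral g)‖ := by
    refine le_norm_incl hω ?_
    filter_upwards [hωQ, hlox, hhiy] with n hn hn1 hn2
    obtain ⟨h, a, b, k, t, i, ht, htm, -, e1, e2⟩ := hn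
    -- By the intermediate value theorem the eigenvalue function takes the value `z`, where `g`
    -- equals 1.
    obtain ⟨w, hw⟩ : z ∈ Set.range (t i) := by
      refine mem_range_of_exists_le_of_exists_ge (t i).continuous ⟨s n, ?_⟩ ⟨s' n, ?_⟩
      · rw [e1]; exact (hn1.trans hxz).le
      · rw [e2]; exact (hzy.trans hn2).le
    refine ⟨h, le_trans (le_of_eq ?_)
      (ht.norm_apply_le_norm ⟨fun w => (g w : ℂ), by fun_prop⟩ i w)⟩
    simp [hw, g, ramp_eq_one hzy (le_refl (z : ℝ)), ramp_eq_zero hxz (le_refl (z : ℝ))]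
  rw [hzero, norm_zero] at hone
  exact absurd hone (by norm_num)

end Necessity

/-! ### Cut-downs of positive elements and ideals -/

section PositiveElements

variable {B : Type*} [CStarAlgebra B]

/-- For a positive element `b = g* g`, the positive part `y` of `b - r` satisfies
`y b y ≥ r y²` and `b ≤ r + y`. -/
theorem exists_cutdown (g : B) (r : ℝ) :
    ∃ y : B, IsSelfAdjoint y ∧
      (∃ w, y * (star g * g) * y = (r : ℂ) • (y * y) + star w * w) ∧
      ∃ z, star g * g + star z * z = (r : ℂ) • 1 + y := by
  let _ := CStarAlgebra.spectralOrder B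
  have := CStarAlgebra.spectralOrderedRing B
  have hb : IsSelfAdjoint (star g * g - (r : ℂ) • 1) := by
    refine (IsSelfAdjoint.star_mul_self g).sub ?_
    rw [isSelfAdjoint_iff, star_smul, star_one]
    simp
  have hbr : star g * g = (r : ℂ) • 1 + (star g * g - (r : ℂ) • 1) := by abel
  generalize star g * g - (r : ℂ) • 1 = d at hb hbr
  have h1 : d⁺ - d⁻ = d := CFC.posPart_sub_negPart d hb
  have h2 : d⁺ * d⁻ = 0 := CFC.posPart_mul_negPart d
  have hp : 0 ≤ d⁺ := CFC.posPart_nonneg d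
  have hn : 0 ≤ d⁻ := CFC.negPart_nonneg d
  have hsa : IsSelfAdjoint d⁺ := hp.isSelfAdjoint
  obtain ⟨v, hv⟩ := CStarAlgebra.nonneg_iff_eq_star_mul_self.1 hp
  obtain ⟨z, hz⟩ := CStarAlgebra.nonneg_iff_eq_star_mul_self.1 hn
  -- Here `d = g* g - r`. From `d⁺ d = d⁺ d⁺` one gets `d⁺ (g* g) d⁺ = r (d⁺)² + (d⁺)³`, and the
  -- cube is a square because `d⁺ = v* v`.
  refine ⟨d⁺, hsa, ⟨v * d⁺, ?_⟩, z, ?_⟩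
  · have h3 : d⁺ * d = d⁺ * d⁺ := by
      have h4 : d⁺ * (d⁺ - d⁻) = d⁺ * d⁺ := by rw [mul_sub, h2, sub_zero]
      rwa [h1] at h4
    rw [hbr, mul_add, h3, add_mul, star_mul, hsa.star_eq, mul_smul_comm, mul_one, smul_mul_assoc]
    congr 1
    rw [mul_assoc (d⁺), mul_assoc, ← mul_assoc (star v), ← hv]
  · rw [hbr, ← hz, add_assoc]
    congr 1
    nth_rewrite 1 [← h1]
    abel

/-- Applied at a point where the cut-down vanishes, this bounds `g* g` there; so where `g* g` is
larger than `r`, the cut-down is nonzero. -/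
theorem norm_star_mul_self_le_of_add_eq {g z : B} {r : ℝ}
    (h : star g * g + star z * z = (r : ℂ) • 1) (hr : 0 ≤ r) : ‖star g * g‖ ≤ r := by
  let _ := CStarAlgebra.spectralOrder B
  have := CStarAlgebra.spectralOrderedRing B
  rw [CStarAlgebra.norm_le_iff_le_algebraMap _ hr (star_mul_self_nonneg g)]
  have h1 : algebraMap ℝ B r = star g * g + star z * z := by
    rw [h, Algebra.algebraMap_eq_smul_one]
    exact (Complex.coe_smul r (1 : B)).symm
  rw [h1]
  exact le_add_of_nonneg_right (star_mul_self_nonneg z)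

/-- An ideal containing a self-adjoint element `a` close to an element `b` that is large on a full
element `y` is the whole algebra. -/
theorem ideal_eq_top_of_full {K : TwoSidedIdeal B} {a b y w : B} {ε : ℝ} (hε : 0 < ε)
    (haK : a ∈ K) (ha : IsSelfAdjoint a) (hb : IsSelfAdjoint b) (hab : ‖a - b‖ ≤ ε)
    (hy : IsSelfAdjoint y) (hyw : y * b * y = ((2 * ε : ℝ) : ℂ) • (y * y) + star w * w)
    {J : Type*} [Fintype J] (z : J → B) (hz : IsUnit (∑ j, star (y * z j) * (y * z j))) :
    K = ⊤ := by
  let _ := CStarAlgebra.spectralOrder B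
  have := CStarAlgebra.spectralOrderedRing B
  have h1 : -algebraMap ℝ B ε ≤ a - b := by
    refine le_trans (neg_le_neg ?_) (ha.sub hb).neg_algebraMap_norm_le_self
    exact algebraMap_mono B hab
  -- Since `a ≥ b - ε` and `y b y ≥ 2 ε y²`, the compression satisfies `y a y ≥ ε y²`; conjugation
  -- by `z j` preserves this.
  have h2 : ∀ j, (ε : ℝ) • (star (y * z j) * (y * z j)) ≤ star (z j) * (y * a * y) * z j := by
    intro j
    have h3 : ε • (y * y) ≤ y * a * y := by
      have h4 := hy.conjugate_le_conjugate h1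
      have h5 : y * -algebraMap ℝ B ε * y = -(ε • (y * y)) := by
        rw [Algebra.algebraMap_eq_smul_one, mul_neg, neg_mul, mul_smul_comm, mul_one,
          smul_mul_assoc]
      have h6 : y * (a - b) * y = y * a * y - y * b * y := by rw [mul_sub, sub_mul]
      have h7 : ((2 * ε : ℝ) : ℂ) • (y * y) = ε • (y * y) + ε • (y * y) := by
        rw [← add_smul, ← two_mul]
        exact Complex.coe_smul (2 * ε) (y * y)
      rw [h5, h6, hyw, h7] at h4
      have h8 := star_mul_self_nonneg w
      calc ε • (y * y) ≤ ε • (y * y) + star w * w := le_add_of_nonneg_right h8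
        _ = -(ε • (y * y)) + (ε • (y * y) + ε • (y * y) + star w * w) := by abel
        _ ≤ y * a * y - (ε • (y * y) + ε • (y * y) + star w * w) +
            (ε • (y * y) + ε • (y * y) + star w * w) := by gcongr
        _ = y * a * y := by abel
    have h9 := star_left_conjugate_le_conjugate h3 (z j)
    refine le_trans (le_of_eq ?_) h9
    rw [star_mul, hy.star_eq, mul_smul_comm, smul_mul_assoc]
    simp only [mul_assoc]
  have h3 : ε • ∑ j, star (y * z j) * (y * z j) ≤ ∑ j, star (z j) * (y * a * y) * z j := by
    rw [Finset.smul_sum]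
    exact Finset.sum_le_sum fun j _ => h2 j
  have h4 : IsStrictlyPositive (ε • ∑ j, star (y * z j) * (y * z j)) := by
    refine IsUnit.isStrictlyPositive ?_ ?_
    · exact (isUnit_smul_iff (Units.mk0 ε hε.ne') _).2 hz
    · exact smul_nonneg hε.le (Finset.sum_nonneg fun j _ => star_mul_self_nonneg _)
  have h5 := CStarAlgebra.isUnit_of_le _ h3 h4
  have h6 : ∑ j, star (z j) * (y * a * y) * z j ∈ K := by
    refine sum_mem fun j _ => ?_
    exact K.mul_mem_right _ _ (K.mul_mem_left _ _ (K.mul_mem_right _ _ (K.mul_mem_left _ _ haK)))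
  obtain ⟨u, hu⟩ := h5
  rw [← hu] at h6
  have h7 : (1 : B) ∈ K := by simpa using K.mul_mem_left (↑u⁻¹) _ h6
  rw [eq_top_iff]
  intro x _
  simpa using K.mul_mem_left x 1 h7

end PositiveElements

/-! ### Nowhere vanishing elements are full -/

section Fullness

open scoped ComplexOrder in
theorem posDef_of_eq_smul_one {n : Type*} [Fintype n] [DecidableEq n] {M : Matrix n n ℂ} {c : ℂ}
    (hc : 0 < c) (h : M = c • 1) : M.PosDef := by
  rw [h]
  exact Matrix.PosDef.one.smul hc

/-- Each term picks out a diagonal entry of `M* M` and places it on a diagonal unit; summing over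
both indices averages `M* M` to a scalar, positive when `M ≠ 0`. -/
theorem sum_star_mul_single {n : Type*} [Fintype n] [DecidableEq n] (M : Matrix n n ℂ) :
    ∑ x : n × n, star (M * Matrix.single x.1 x.2 1) * (M * Matrix.single x.1 x.2 1) =
      (star M * M).trace • (1 : Matrix n n ℂ) := by
  have h : ∀ i k : n, star (M * Matrix.single i k (1 : ℂ)) * (M * Matrix.single i k 1) =
      (star M * M) i i • Matrix.single k k 1 := by
    intro i k
    rw [star_mul, Matrix.star_eq_conjTranspose (Matrix.single i k (1 : ℂ)),
      Matrix.conjTranspose_single, mul_assoc, ← mul_assoc (star M), ← mul_assoc,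
      Matrix.single_mul_mul_single]
    simp
  rw [Fintype.sum_prod_type]
  simp only [h]
  rw [Finset.sum_comm]
  simp only [← Finset.sum_smul, ← Finset.smul_sum]
  rw [show ∑ k, Matrix.single k k (1 : ℂ) = (1 : Matrix n n ℂ) from Matrix.sum_single_one]
  rfl

variable {p q : ℕ} [NeZero p] [NeZero q]

open scoped ComplexOrder in
/-- A nowhere vanishing element of a dimension drop algebra is full. -/
theorem exists_isUnit_sum_of_ne_zero {y : DimDrop p q} (hy : ∀ s, y.1 s ≠ 0) :
    ∃ (J : Type) (_ : Fintype J) (z : J → DimDrop p q),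
      IsUnit (∑ j, star (y * z j) * (y * z j)) := by
  -- Matrix units of the full algebra are available only in the interior, so the two ends need their
  -- own families. At each point one family yields a positive definite sum, and the others add
  -- positive semidefinite terms.
  let χ : C(I, ℂ) := ⟨fun s => ((s : ℝ) * (1 - (s : ℝ)) : ℂ), by fun_prop⟩
  let χ₀ : C(I, ℂ) := ⟨fun s => (1 - (s : ℝ) : ℂ), by fun_prop⟩
  let χ₁ : C(I, ℂ) := ⟨fun s => ((s : ℝ) : ℂ), by fun_prop⟩
  let z₂ : (Fin p × Fin q) × (Fin p × Fin q) → DimDrop p q := fun x =>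
    innerElt χ (by simp [χ]) (by simp [χ]) (Matrix.single x.1 x.2 1)
  let z₀ : Fin p × Fin p → DimDrop p q := fun x =>
    leftElt χ₀ (by simp [χ₀]) (Matrix.single x.1 x.2 1)
  let z₁ : Fin q × Fin q → DimDrop p q := fun x =>
    rightElt χ₁ (by simp [χ₁]) (Matrix.single x.1 x.2 1)
  have hsum : ∀ {J : Type} [Fintype J] (z : J → DimDrop p q) (s : I),
      (∑ j, star (y * z j) * (y * z j)).1 s =
        ∑ j, star (y.1 s * (z j).1 s) * (y.1 s * (z j).1 s) := by
    intro J _ z s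
    exact map_sum (evalHom s : DimDrop p q →⋆ₐ[ℂ] _) _ _
  have hpsd : ∀ {J : Type} [Fintype J] (z : J → DimDrop p q) (s : I),
      (∑ j, star (y.1 s * (z j).1 s) * (y.1 s * (z j).1 s)).PosSemidef := fun z s =>
    Matrix.posSemidef_sum _ fun j _ => Matrix.posSemidef_conjTranspose_mul_self _
  have htr : ∀ {n : Type} [Fintype n] [DecidableEq n] (M : Matrix n n ℂ), M ≠ 0 →
      0 < (star M * M).trace := by
    intro n _ _ M hM
    refine lt_of_le_of_ne (Matrix.posSemidef_conjTranspose_mul_self M).trace_nonneg fun h => hM ?_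
    exact Matrix.trace_conjTranspose_mul_self_eq_zero_iff.1 h.symm
  refine ⟨((Fin p × Fin q) × (Fin p × Fin q)) ⊕ (Fin p × Fin p) ⊕ (Fin q × Fin q),
    inferInstance, Sum.elim z₂ (Sum.elim z₀ z₁), ?_⟩
  -- By spectral permanence, invertibility may be tested among all continuous matrix functions,
  -- hence pointwise.
  rw [← StarSubalgebra.coe_isUnit, ContinuousMap.isUnit_iff_forall_isUnit]
  intro s
  refine Matrix.PosDef.isUnit ?_
  rw [hsum, Fintype.sum_sum_type, Fintype.sum_sum_type]
  simp only [Sum.elim_inl, Sum.elim_inr]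
  by_cases h0 : s = 0
  · subst h0
    refine Matrix.PosDef.posSemidef_add (hpsd z₂ 0) (Matrix.PosDef.add_posSemidef ?_ (hpsd z₁ 0))
    have hne : leftEnd y ≠ 0 := fun h => hy 0 (by rw [leftEnd_kronecker_one, h]; simp)
    refine posDef_of_eq_smul_one (htr _ hne) ?_
    have h1 : ∀ j, y.1 0 * (z₀ j).1 0 =
        (leftEnd y * Matrix.single j.1 j.2 1) ⊗ₖ (1 : Matrix (Fin q) (Fin q) ℂ) := by
      intro j
      rw [leftEnd_kronecker_one, leftElt_apply]
      simp [χ₀, ← Matrix.mul_kronecker_mul]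
    have h2 : ∀ A : Matrix (Fin p) (Fin p) ℂ, star (A ⊗ₖ (1 : Matrix (Fin q) (Fin q) ℂ)) *
        (A ⊗ₖ (1 : Matrix (Fin q) (Fin q) ℂ)) = (star A * A) ⊗ₖ 1 := by
      intro A
      rw [Matrix.star_eq_conjTranspose, Matrix.conjTranspose_kronecker, Matrix.conjTranspose_one,
        ← Matrix.mul_kronecker_mul, mul_one, Matrix.star_eq_conjTranspose]
    simp only [h1, h2]
    have h3 : ∀ {J : Type} [Fintype J] (A : J → Matrix (Fin p) (Fin p) ℂ),
        ∑ j, A j ⊗ₖ (1 : Matrix (Fin q) (Fin q) ℂ) = (∑ j, A j) ⊗ₖ 1 := fun A => by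
      ext
      simp [Matrix.sum_apply, Finset.sum_mul]
    rw [h3, sum_star_mul_single, Matrix.smul_kronecker, Matrix.one_kronecker_one]
  by_cases h1 : s = 1
  · subst h1
    refine Matrix.PosDef.posSemidef_add (hpsd z₂ 1) (Matrix.PosDef.posSemidef_add (hpsd z₀ 1) ?_)
    have hne : rightEnd y ≠ 0 := fun h => hy 1 (by rw [one_kronecker_rightEnd, h]; simp)
    refine posDef_of_eq_smul_one (htr _ hne) ?_
    have h1 : ∀ j, y.1 1 * (z₁ j).1 1 =
        (1 : Matrix (Fin p) (Fin p) ℂ) ⊗ₖ (rightEnd y * Matrix.single j.1 j.2 1) := by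
      intro j
      rw [one_kronecker_rightEnd, rightElt_apply]
      simp [χ₁, ← Matrix.mul_kronecker_mul]
    have h2 : ∀ A : Matrix (Fin q) (Fin q) ℂ, star ((1 : Matrix (Fin p) (Fin p) ℂ) ⊗ₖ A) *
        ((1 : Matrix (Fin p) (Fin p) ℂ) ⊗ₖ A) = 1 ⊗ₖ (star A * A) := by
      intro A
      rw [Matrix.star_eq_conjTranspose, Matrix.conjTranspose_kronecker, Matrix.conjTranspose_one,
        ← Matrix.mul_kronecker_mul, mul_one, Matrix.star_eq_conjTranspose]
    simp only [h1, h2]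
    have h3 : ∀ {J : Type} [Fintype J] (A : J → Matrix (Fin q) (Fin q) ℂ),
        ∑ j, (1 : Matrix (Fin p) (Fin p) ℂ) ⊗ₖ A j = 1 ⊗ₖ (∑ j, A j) := fun A => by
      ext
      simp [Matrix.sum_apply, Finset.mul_sum]
    rw [h3, sum_star_mul_single, Matrix.kronecker_smul, Matrix.one_kronecker_one]
  · refine Matrix.PosDef.add_posSemidef ?_ ((hpsd z₀ s).add (hpsd z₁ s))
    have hχ : χ s ≠ 0 := by
      refine mul_ne_zero ?_ (sub_ne_zero.2 ?_)
      · exact_mod_cast fun h : (s : ℝ) = 0 => h0 (Subtype.ext h)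
      · exact_mod_cast fun h : (1 : ℝ) = s => h1 (Subtype.ext h.symm)
    refine posDef_of_eq_smul_one (htr _ (smul_ne_zero hχ (hy s))) ?_
    rw [← sum_star_mul_single]
    refine Finset.sum_congr rfl fun j _ => ?_
    rw [innerElt_apply, mul_smul_comm, smul_mul_assoc]

/-- An ideal that contains an element close to the image of `g* g`, where `g* g` is uniformly
large at every point, is the whole algebra. -/
theorem ideal_eq_top_of_lt_norm_apply {B : Type*} [CStarAlgebra B] (Φ : DimDrop p q →⋆ₐ[ℂ] B)
    {K : TwoSidedIdeal B} {a : B} {ε : ℝ} (hε : 0 < ε) (haK : a ∈ K) (ha : IsSelfAdjoint a)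
    (g : DimDrop p q) (hg : ∀ s, 2 * ε < ‖star (g.1 s) * g.1 s‖)
    (hag : ‖a - star (Φ g) * Φ g‖ ≤ ε) : K = ⊤ := by
  obtain ⟨y, hy, ⟨w, hw⟩, z, hz⟩ := exists_cutdown g (2 * ε)
  have hy0 : ∀ s, y.1 s ≠ 0 := by
    intro s hs
    refine (hg s).not_ge (norm_star_mul_self_le_of_add_eq (z := z.1 s) ?_ (by positivity))
    have h1 : star (g.1 s) * g.1 s + star (z.1 s) * z.1 s = ((2 * ε : ℝ) : ℂ) • 1 + y.1 s :=
      congrArg (fun f : DimDrop p q => f.1 s) hz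
    rw [h1, hs, add_zero]
  obtain ⟨J, _, x, hx⟩ := exists_isUnit_sum_of_ne_zero hy0
  refine ideal_eq_top_of_full (b := star (Φ g) * Φ g) (y := Φ y) (w := Φ w) hε haK ha
    (IsSelfAdjoint.star_mul_self _) hag (hy.map Φ) ?_ (fun j => Φ (x j)) ?_
  · have h1 := congrArg Φ hw
    simpa only [map_mul, map_add, map_smul, map_star] using h1
  · have h1 := hx.map Φ
    simpa only [map_sum, map_mul, map_star] using h1

end Fullness

/-! ### Small variation implies simplicity -/

section Simplicity

/-- The approximation persists at all later stages, which leaves `n` free to be chosen so large that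
the values are nearly constant. -/
theorem exists_norm_star_mul_self_sub_incl_le {A : ℕ → Type*} [∀ n, CStarAlgebra (A n)]
    {S : CStarSystem A} (x : S.Limit) {ε : ℝ} (hε : 0 < ε) :
    ∃ (m : ℕ) (a : A m), ∀ (n : ℕ) (h : m ≤ n),
      ‖star x * x - star (S.incl n (S.map h a)) * S.incl n (S.map h a)‖ ≤ ε := by
  simp only [incl_map]
  by_contra! hcon
  have : ε ≤ ‖star x * x - star x * x‖ := by
    refine Limit.ind_incl (P := fun y => ε ≤ ‖star x * x - star y * y‖) x
      (isClosed_le continuous_const (by fun_prop)) fun m a => (hcon m a).elim fun _ h => h.2.le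
  rw [sub_self, norm_zero] at this
  linarith

theorem norm_conj_unitary {n : Type*} [Fintype n] [DecidableEq n] {u : Matrix n n ℂ}
    (hu : u ∈ Matrix.unitaryGroup n ℂ) (M : Matrix n n ℂ) : ‖u * M * star u‖ = ‖M‖ := by
  rw [CStarRing.norm_mul_mem_unitary _ (Unitary.star_mem hu),
    CStarRing.norm_mem_unitary_mul _ hu]

/-- An ideal that contains an element `x` whose square `x* x` is close to the image of `g* g`,
where the values of `g` are nearly unitarily equivalent to each other, is the whole algebra. -/
theorem ideal_eq_top_of_nearly_constant {p q : ℕ} [NeZero p] [NeZero q] {B : Type*}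
    [CStarAlgebra B] (Φ : DimDrop p q →⋆ₐ[ℂ] B) {K : TwoSidedIdeal B} {x : B} (hxK : x ∈ K)
    {c : ℝ} (hc : 0 < c) (hcx : ‖x‖ = 3 * c) (g : DimDrop p q)
    (hxg : ‖star x * x - star (Φ g) * Φ g‖ ≤ c * c)
    (hgs : ∀ s s' : I, ∃ u ∈ Matrix.unitaryGroup (Fin p × Fin q) ℂ,
      ‖g.1 s - u * g.1 s' * star u‖ ≤ c) : K = ⊤ := by
  -- From `‖x‖² = 9c²` one gets `‖Φ g‖² ≥ 8c² > (14/5)² c²`. Some value of `g` then has norm above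
  -- `13/5 c`, hence every value has norm above `8/5 c`, and `(8/5)² > 2` is what the cut-down at
  -- `2c²` needs.
  have hgn : 14 / 5 * c ≤ ‖g‖ := by
    refine le_trans ?_ (DimDrop.norm_map_le Φ g)
    have := norm_le_norm_add_norm_sub' (star x * x) (star (Φ g) * Φ g)
    rw [CStarRing.norm_star_mul_self, CStarRing.norm_star_mul_self, hcx] at this
    by_contra! h
    nlinarith [norm_nonneg (Φ g)]
  obtain ⟨s₀, hs₀⟩ : ∃ s, 13 / 5 * c < ‖g.1 s‖ := by
    by_contra! h
    have := DimDrop.norm_le (by positivity) h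
    linarith
  refine ideal_eq_top_of_lt_norm_apply Φ (mul_pos hc hc) (K.mul_mem_left _ _ hxK)
    (IsSelfAdjoint.star_mul_self x) g (fun s => ?_) hxg
  obtain ⟨u, hu, hus⟩ := hgs s₀ s
  have h1 := norm_le_norm_add_norm_sub' (g.1 s₀) (u * g.1 s * star u)
  rw [norm_conj_unitary hu] at h1
  rw [CStarRing.norm_star_mul_self]
  nlinarith

variable {p q : ℕ → ℕ} [∀ n, NeZero (p n)] [∀ n, NeZero (q n)]
  {S : CStarSystem (fun n => DimDrop (p n) (q n))}

theorem isSimple_of_variation_tendsto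
    (hV : ∀ m : ℕ, Tendsto (fun n : Set.Ici m => variation (S.map n.2)) atTop (𝓝 0)) :
    IsSimpleCStarAlgebra S.Limit := by
  refine ⟨nontrivial_limit S, fun K _ => or_iff_not_imp_left.2 fun hK => ?_⟩
  obtain ⟨x, hxK, hx⟩ : ∃ x ∈ K, x ≠ 0 := by
    by_contra! h
    exact hK (le_bot_iff.1 fun x hx => (TwoSidedIdeal.mem_bot _).2 (h x hx))
  obtain ⟨c, hc, hcx⟩ : ∃ c > 0, ‖x‖ = 3 * c :=
    ⟨‖x‖ / 3, div_pos (norm_pos_iff.2 hx) three_pos, by ring⟩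
  obtain ⟨m, f, hf⟩ := exists_norm_star_mul_self_sub_incl_le x (mul_pos hc hc)
  obtain ⟨n, hn, hmn⟩ := ((eventually_nearly_constant hV f hc).and
    (eventually_ge_atTop m)).exists
  exact ideal_eq_top_of_nearly_constant (S.incl n) hxK hc hcx (S.map hmn f) (hf n hmn) (hn hmn)

end Simplicity

end JiangSu

end

theorem mainTheorem4 (p q : ℕ → ℕ) [∀ n, NeZero (p n)] [∀ n, NeZero (q n)]
    (hpq : ∀ n, Nat.Coprime (p n) (q n))
    (S : JiangSu.CStarSystem (fun n => JiangSu.DimDrop (p n) (q n))) :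
    (JiangSu.IsSimpleCStarAlgebra S.Limit ∧ JiangSu.IsMonotracial S.Limit) ↔
      ∀ m : ℕ, Tendsto (fun n : Set.Ici m => JiangSu.variation (S.map n.2)) atTop (𝓝 0) :=
  ⟨fun h m => JiangSu.tendsto_variation_of_isSimple_of_isMonotracial hpq h.1 h.2 m,
    fun hV => ⟨JiangSu.isSimple_of_variation_tendsto hV,
      JiangSu.isMonotracial_of_variation_tendsto hV⟩⟩
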